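/- **Nullspace, nondegeneracy, and resonance.** All functions on $\mathbb{R}$ are real-valued and identified when equal almost everywhere. For $k \in \mathbb{N}$ let $$f_k(x) = \mathrm{Re}\Big(\mathrm{i}\,\frac{x-\mathrm{i}}{x+\mathrm{i}}\Big)^k, \qquad g_k(x) = \mathrm{Im}\Big(\mathrm{i}\,\frac{x-\mathrm{i}}{x+\mathrm{i}}\Big)^k ,$$ and for $m \geq 1$ let $\mathbf{Q}_m = (f_m, g_m, 0) : \mathbb{R} \to \mathbb{S}^2$ be the pure-power half-harmonic map of degree $m$. Let $\dot{H}^{1/2}(\mathbb{R})$ be the space of all $\varphi$ with $$\int_{\mathbb{R}} \frac{|\varphi(x)|}{1+x^2}\,dx < \infty \quad\text{and}\quad \frac{1}{2\pi} \iint_{\mathbb{R}\times\mathbb{R}} \frac{|\varphi(x)-\varphi(y)|^2}{|x-y|^2}\,dx\,dy < \infty .$$ Let $|\nabla| = \sqrt{-\Delta}$, that is, $(|\nabla|\psi)(x) = \frac{1}{\pi}\,\mathrm{p.v.}\!\int_{\mathbb{R}} \frac{\psi(x)-\psi(y)}{|x-y|^2}\,dy$ for $\psi \in C_c^\infty(\mathbb{R})$,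 extended by duality to $\varphi \in \dot{H}^{1/2}(\mathbb{R})$ through $\langle |\nabla|\varphi, \psi\rangle = \int_{\mathbb{R}} \varphi\, |\nabla|\psi\,dx$. Set $$L_+ = |\nabla| - |\partial_x \mathbf{Q}_m|, \qquad L_- = L_+ + R, \qquad (R\varphi)(x) = \frac{1}{2\pi}\int_{\mathbb{R}} \frac{|\mathbf{Q}_m(x)-\mathbf{Q}_m(y)|^2}{|x-y|^2}\,\varphi(y)\,dy ,$$ and $\mathcal{N}(L_\pm) = \{\varphi \in \dot{H}^{1/2}(\mathbb{R}) : L_\pm \varphi = 0 \text{ in } \mathcal{D}'(\mathbb{R})\}$. Then for every $m \geq 1$: $$\mathcal{N}(L_+) = \mathrm{span}\{f_m, g_m\}, \qquad \mathcal{N}(L_-) = \mathrm{span}\{1, f_1, \ldots, f_m, g_1, \ldots, g_m\}.$$ Consequently $\dim \mathcal{N}(L_+) = 2$ and $\dim \mathcal{N}(L_-) = 2m+1$, which is the nondegeneracy of the linearized operator $L = \mathrm{diag}(L_+, L_-)$ around $\mathbf{Q}_m$. Moreover, $L_+$ and $L_-$ have a common resonance $\varphi \in \dot{H}^{1/2}(\mathbb{R})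 \setminus L^2(\mathbb{R})$ with $L_+\varphi = L_-\varphi = 0$, given by $$\varphi = g_m \ \text{ if } m \text{ is odd}, \qquad \varphi = f_m \ \text{ if } m \text{ is even}.$$ -/

import Mathlib

open MeasureTheory

noncomputable section

namespace HalfHarmonic

/-- `z(x) = i (x - i) / (x + i)`, the inverse stereographic projection `ℝ → 𝕊¹`. -/
def z (x : ℝ) : ℂ := Complex.I * (((x : ℂ) - Complex.I) / ((x : ℂ) + Complex.I))

/-- `f_k = Re z^k`. -/
def f (k : ℕ) (x : ℝ) : ℝ := (z x ^ k).re

/-- `g_k = Im z^k`. -/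
def g (k : ℕ) (x : ℝ) : ℝ := (z x ^ k).im

/-- The pure-power half-harmonic map `Q_m = (f_m, g_m, 0)` of degree `m`. -/
def Q (m : ℕ) (x : ℝ) : EuclideanSpace ℝ (Fin 3) := !₂[f m x, g m x, 0]

/-- `|∇| ψ` for a test function `ψ`, where `|∇| = √(-Δ)` on `ℝ`: the singular integral
`(1/π) p.v. ∫ (ψ(x) - ψ(y)) / |x - y|² dy`. The principal value is taken by pairing
`y = x + h` with `y = x - h`, which makes the integral absolutely convergent. -/
def absNabla (ψ : ℝ → ℝ) (x : ℝ) : ℝ :=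
  Real.pi⁻¹ * ∫ h in Set.Ioi (0 : ℝ), (2 * ψ x - ψ (x + h) - ψ (x - h)) / h ^ 2

/-- The kernel `|Q_m(x) - Q_m(y)|² / |x - y|²`. -/
def kernel (m : ℕ) (x y : ℝ) : ℝ := ‖Q m x - Q m y‖ ^ 2 / |x - y| ^ 2

/-- `(R φ)(x) = (1/2π) ∫ |Q_m(x) - Q_m(y)|² / |x - y|² φ(y) dy`. -/
def R (m : ℕ) (φ : ℝ → ℝ) (x : ℝ) : ℝ := (2 * Real.pi)⁻¹ * ∫ y, kernel m x y * φ y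

/-- The distribution `L₊ φ = |∇| φ - |∂ₓ Q_m| φ` evaluated at the test function `ψ`;
`|∇| φ` is defined by duality. -/
def Lplus (m : ℕ) (φ ψ : ℝ → ℝ) : ℝ :=
  (∫ x, φ x * absNabla ψ x) - ∫ x, ‖deriv (Q m) x‖ * φ x * ψ x

/-- The distribution `L₋ φ = L₊ φ + R φ` evaluated at the test function `ψ`. -/
def Lminus (m : ℕ) (φ ψ : ℝ → ℝ) : ℝ :=
  Lplus m φ ψ + ∫ x, R m φ x * ψ x

/-- Membership in `L_{1/2}(ℝ)`: `∫ |φ(x)| / (1 + x²) dx < ∞`. -/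
def MemLHalf (φ : ℝ → ℝ) : Prop := Integrable fun x : ℝ => φ x / (1 + x ^ 2)

/-- The squared seminorm `(1/2π) ∬ |φ(x) - φ(y)|² / |x - y|² dx dy` of `Ḣ^{1/2}(ℝ)`. -/
def seminormSq (φ : ℝ → ℝ) : ENNReal :=
  ENNReal.ofReal (2 * Real.pi)⁻¹ *
    ∫⁻ p : ℝ × ℝ, ENNReal.ofReal (|φ p.1 - φ p.2| ^ 2 / |p.1 - p.2| ^ 2)

/-! ### Facts that make the spaces below linear -/

lemma continuous_z : Continuous z := by
  unfold z
  refine continuous_const.mul (Continuous.div (by fun_prop) (by fun_prop) ?_)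
  intro x h
  have := congrArg Complex.im h
  simp at this

lemma continuous_f (k : ℕ) : Continuous (f k) :=
  Complex.continuous_re.comp (continuous_z.pow k)

lemma continuous_g (k : ℕ) : Continuous (g k) :=
  Complex.continuous_im.comp (continuous_z.pow k)

lemma contDiff_z : ContDiff ℝ 1 z := by
  have hx : ContDiff ℝ 1 (fun x : ℝ => (x : ℂ)) := Complex.ofRealCLM.contDiff
  unfold z
  simp only [div_eq_mul_inv]
  refine contDiff_const.mul ((hx.sub contDiff_const).mul ((hx.add contDiff_const).inv ?_))
  intro x h
  have := congrArg Complex.im h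
  simp at this

lemma contDiff_Q (m : ℕ) : ContDiff ℝ 1 (Q m) := by
  have hf : ContDiff ℝ 1 (f m) := Complex.reCLM.contDiff.comp (contDiff_z.pow m)
  have hg : ContDiff ℝ 1 (g m) := Complex.imCLM.contDiff.comp (contDiff_z.pow m)
  rw [contDiff_euclidean]
  intro i
  fin_cases i
  · simpa [Q] using hf
  · simpa [Q] using hg
  · simpa [Q] using (contDiff_const : ContDiff ℝ 1 fun _ : ℝ => (0 : ℝ))

lemma normSq_add_I (x : ℝ) : ‖(x : ℂ) + Complex.I‖ ^ 2 = 1 + x ^ 2 := by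
  rw [← Complex.normSq_eq_norm_sq]; simp [Complex.normSq_apply]; ring

lemma norm_z (x : ℝ) : ‖z x‖ = 1 := by
  have h1 : ‖(x : ℂ) - Complex.I‖ = ‖(x : ℂ) + Complex.I‖ := by
    rw [← Complex.norm_conj]; simp
  have h2 : ‖(x : ℂ) + Complex.I‖ ≠ 0 := by
    intro h
    have := normSq_add_I x
    rw [h] at this
    nlinarith [sq_nonneg x]
  simp [z, h1, h2]

lemma norm_z_sub (x y : ℝ) :
    ‖z x - z y‖ ^ 2 = 4 * |x - y| ^ 2 / ((1 + x ^ 2) * (1 + y ^ 2)) := by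
  have ne (t : ℝ) : (t : ℂ) + Complex.I ≠ 0 := by
    intro h
    have := congrArg Complex.im h
    simp at this
  have h : z x - z y =
      -2 * ((x - y : ℝ) : ℂ) / (((x : ℂ) + Complex.I) * ((y : ℂ) + Complex.I)) := by
    have hx := ne x
    have hy := ne y
    unfold z
    field_simp
    push_cast
    linear_combination 2 * ((x : ℂ) - y) * Complex.I_sq
  rw [h, norm_div, norm_mul, norm_mul, div_pow, mul_pow, mul_pow, normSq_add_I, normSq_add_I,
    Complex.norm_real, Real.norm_eq_abs]
  norm_num

lemma norm_pow_sub_le {a b : ℂ} (ha : ‖a‖ = 1) (hb : ‖b‖ = 1) (m : ℕ) :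
    ‖a ^ m - b ^ m‖ ≤ m * ‖a - b‖ := by
  induction m with
  | zero => simp
  | succ k ih =>
    have : a ^ (k + 1) - b ^ (k + 1) = a ^ k * (a - b) + (a ^ k - b ^ k) * b := by ring
    rw [this]
    refine (norm_add_le _ _).trans ?_
    rw [norm_mul, norm_mul, norm_pow, ha, hb, one_pow]
    push_cast
    linarith

lemma norm_Q_sub (m : ℕ) (x y : ℝ) : ‖Q m x - Q m y‖ = ‖z x ^ m - z y ^ m‖ := by
  rw [EuclideanSpace.norm_eq, Complex.norm_eq_sqrt_sq_add_sq]
  congr 1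
  simp [Fin.sum_univ_three, Q, f, g]

lemma kernel_nonneg (m : ℕ) (x y : ℝ) : 0 ≤ kernel m x y := by
  unfold kernel; positivity

lemma kernel_le (m : ℕ) (x y : ℝ) : kernel m x y * (1 + y ^ 2) ≤ 4 * (m : ℝ) ^ 2 := by
  unfold kernel
  rw [norm_Q_sub]
  rcases eq_or_ne x y with rfl | hxy
  · simp
  have h0 : 0 < |x - y| ^ 2 := pow_pos (abs_pos.mpr (sub_ne_zero.mpr hxy)) 2
  have h1 : ‖z x ^ m - z y ^ m‖ ^ 2 ≤ (m * ‖z x - z y‖) ^ 2 :=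
    pow_le_pow_left₀ (norm_nonneg _) (norm_pow_sub_le (norm_z x) (norm_z y) m) 2
  rw [mul_pow, norm_z_sub] at h1
  have hy : 0 < 1 + y ^ 2 := by positivity
  have hx : 0 < 1 + x ^ 2 := by positivity
  have h2 : ‖z x ^ m - z y ^ m‖ ^ 2 / |x - y| ^ 2 * (1 + y ^ 2) ≤
      (m : ℝ) ^ 2 * (4 * |x - y| ^ 2 / ((1 + x ^ 2) * (1 + y ^ 2))) / |x - y| ^ 2 *
        (1 + y ^ 2) := by gcongr
  refine h2.trans ?_
  have h3 : (m : ℝ) ^ 2 * (4 * |x - y| ^ 2 / ((1 + x ^ 2) * (1 + y ^ 2))) / |x - y| ^ 2 *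
        (1 + y ^ 2) = 4 * (m : ℝ) ^ 2 / (1 + x ^ 2) := by
    field_simp
  rw [h3]
  exact div_le_self (by positivity) (by nlinarith [sq_nonneg x])

lemma measurable_kernel (m : ℕ) : Measurable (Function.uncurry (kernel m)) := by
  have hQ := (contDiff_Q m).continuous
  unfold kernel Function.uncurry
  have h1 : Continuous fun p : ℝ × ℝ => ‖Q m p.1 - Q m p.2‖ ^ 2 := by fun_prop
  have h2 : Continuous fun p : ℝ × ℝ => |p.1 - p.2| ^ 2 := by fun_prop
  exact h1.measurable.div h2.measurable

lemma MemLHalf.mul {φ w : ℝ → ℝ} (hφ : MemLHalf φ) (hw : AEStronglyMeasurable w)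
    {C : ℝ} (hC : ∀ x, |w x| * (1 + x ^ 2) ≤ C) : Integrable fun x => φ x * w x := by
  have h := Integrable.mul_bdd (c := C) (g := fun x : ℝ => w x * (1 + x ^ 2)) hφ
    (hw.mul (by fun_prop : Continuous fun x : ℝ => 1 + x ^ 2).aestronglyMeasurable)
    (Filter.Eventually.of_forall fun x => by
      rw [Real.norm_eq_abs, abs_mul, abs_of_pos (by positivity : 0 < 1 + x ^ 2)]
      exact hC x)
  refine h.congr (Filter.Eventually.of_forall fun x => ?_)
  have : (1 + x ^ 2 : ℝ) ≠ 0 := by positivity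
  simp only
  field_simp

lemma integrable_kernel {m : ℕ} {φ : ℝ → ℝ} (hφ : MemLHalf φ) (x : ℝ) :
    Integrable fun y => kernel m x y * φ y := by
  have := hφ.mul (w := kernel m x) (C := 4 * (m : ℝ) ^ 2)
    ((measurable_kernel m).comp measurable_prodMk_left).aestronglyMeasurable
    (fun y => by rw [abs_of_nonneg (kernel_nonneg m x y)]; exact kernel_le m x y)
  simpa [mul_comm] using this

lemma R_bound {m : ℕ} {φ : ℝ → ℝ} (hφ : MemLHalf φ) : ∃ C, ∀ x, |R m φ x| ≤ C := by
  refine ⟨(2 * Real.pi)⁻¹ * ∫ y, 4 * (m : ℝ) ^ 2 * ‖φ y / (1 + y ^ 2)‖, fun x => ?_⟩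
  unfold R
  rw [abs_mul, abs_of_pos (by positivity : 0 < (2 * Real.pi)⁻¹)]
  gcongr
  rw [← Real.norm_eq_abs]
  refine norm_integral_le_of_norm_le (hφ.norm.const_mul _) (Filter.Eventually.of_forall ?_)
  intro y
  have hy : 0 < 1 + y ^ 2 := by positivity
  rw [norm_mul, norm_div, Real.norm_eq_abs (kernel m x y), abs_of_nonneg (kernel_nonneg m x y),
    Real.norm_eq_abs (1 + y ^ 2), abs_of_pos hy, mul_div_assoc', le_div_iff₀ hy]
  nlinarith [mul_le_mul_of_nonneg_right (kernel_le m x y) (norm_nonneg (φ y))]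

lemma integrable_R_mul {m : ℕ} {φ : ℝ → ℝ} (hφ : MemLHalf φ) (hm : StronglyMeasurable φ)
    {ψ : ℝ → ℝ} (hψ : Continuous ψ) (hc : HasCompactSupport ψ) :
    Integrable fun x => R m φ x * ψ x := by
  obtain ⟨C, hC⟩ := R_bound (m := m) hφ
  have hR : StronglyMeasurable (R m φ) := by
    unfold R
    refine StronglyMeasurable.const_mul ?_ _
    refine StronglyMeasurable.integral_prod_right
      (f := fun x y => kernel m x y * φ y) ?_
    exact ((measurable_kernel m).mul (hm.measurable.comp measurable_snd)).stronglyMeasurable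
  exact (hψ.integrable_of_hasCompactSupport hc).bdd_mul hR.aestronglyMeasurable
    (Filter.Eventually.of_forall hC)

lemma integrable_potential {m : ℕ} {φ : ℝ → ℝ} (hφ : MemLHalf φ)
    {ψ : ℝ → ℝ} (hψ : Continuous ψ) (hc : HasCompactSupport ψ) :
    Integrable fun x => ‖deriv (Q m) x‖ * φ x * ψ x := by
  have hd : Continuous (deriv (Q m)) := (contDiff_Q m).continuous_deriv le_rfl
  have hw : Continuous fun x => ‖deriv (Q m) x‖ * ψ x := hd.norm.mul hψ
  have hw2 : Continuous fun x : ℝ => (‖deriv (Q m) x‖ * ψ x) * (1 + x ^ 2) := by fun_prop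
  have hcs : HasCompactSupport fun x : ℝ => (‖deriv (Q m) x‖ * ψ x) * (1 + x ^ 2) :=
    (hc.mul_left (f := fun x => ‖deriv (Q m) x‖)).mul_right
  obtain ⟨C, hC⟩ := hcs.exists_bound_of_continuous hw2
  have := hφ.mul (w := fun x => ‖deriv (Q m) x‖ * ψ x) (C := C) hw.aestronglyMeasurable
    (fun x => by
      have := hC x
      rwa [Real.norm_eq_abs, abs_mul, abs_of_pos (by positivity : 0 < 1 + x ^ 2)] at this)
  refine this.congr (Filter.Eventually.of_forall fun x => ?_)
  simp only
  ring

lemma second_difference_le {ψ : ℝ → ℝ} (hψ : ContDiff ℝ (⊤ : ℕ∞) ψ) (hc : HasCompactSupport ψ) :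
    ∃ B, 0 ≤ B ∧ ∀ x h, 0 ≤ h → |2 * ψ x - ψ (x + h) - ψ (x - h)| ≤ B * h ^ 2 := by
  have hd1 : ContDiff ℝ 1 (deriv ψ) :=
    ((contDiff_infty_iff_deriv.mp hψ).2).of_le (by exact_mod_cast le_top)
  obtain ⟨K, hK⟩ := hd1.lipschitzWith_of_hasCompactSupport hc.deriv one_ne_zero
  have hdiff : Differentiable ℝ ψ := hψ.differentiable (by simp)
  refine ⟨2 * K, by positivity, fun x h hh => ?_⟩
  have hF (t : ℝ) : HasDerivAt (fun s => 2 * ψ x - ψ (x + s) - ψ (x - s))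
      (-deriv ψ (x + t) + deriv ψ (x - t)) t := by
    have h1 : HasDerivAt (fun s => ψ (x + s)) (deriv ψ (x + t)) t :=
      (hdiff (x + t)).hasDerivAt.comp_const_add x t
    have h2 : HasDerivAt (fun s => ψ (x - s)) (-deriv ψ (x - t)) t :=
      (hdiff (x - t)).hasDerivAt.comp_const_sub x t
    have := (h1.const_sub (2 * ψ x)).sub h2
    rw [sub_neg_eq_add] at this
    exact this
  have key := (convex_Icc (0 : ℝ) h).norm_image_sub_le_of_norm_hasDerivWithin_le
    (C := 2 * K * h) (fun t _ => (hF t).hasDerivWithinAt) (fun t ht => by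
      have := hK.dist_le_mul (x - t) (x + t)
      rw [Real.dist_eq, Real.dist_eq] at this
      have e : |x - t - (x + t)| = 2 * t := by
        rw [show x - t - (x + t) = -(2 * t) by ring, abs_neg, abs_of_nonneg (by linarith [ht.1])]
      rw [e] at this
      rw [Real.norm_eq_abs, show -deriv ψ (x + t) + deriv ψ (x - t) =
        deriv ψ (x - t) - deriv ψ (x + t) by ring]
      refine this.trans ?_
      nlinarith [mul_le_mul_of_nonneg_left ht.2 K.coe_nonneg])
    (Set.left_mem_Icc.mpr hh) (Set.right_mem_Icc.mpr hh)
  simp only [add_zero, sub_zero, Real.norm_eq_abs, abs_of_nonneg hh] at key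
  rw [show 2 * ψ x - ψ (x + h) - ψ (x - h) =
    2 * ψ x - ψ (x + h) - ψ (x - h) - (2 * ψ x - ψ x - ψ x) by ring]
  refine key.trans (le_of_eq ?_)
  ring

lemma absNabla_bound {ψ : ℝ → ℝ} (hψ : ContDiff ℝ (⊤ : ℕ∞) ψ) (hc : HasCompactSupport ψ) :
    ∃ C, ∀ x, |absNabla ψ x| * (1 + x ^ 2) ≤ C := by
  obtain ⟨B, hB0, hB⟩ := second_difference_le hψ hc
  obtain ⟨A, hA⟩ := hc.exists_bound_of_continuous hψ.continuous
  simp only [Real.norm_eq_abs] at hA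
  have hA0 : 0 ≤ A := (abs_nonneg _).trans (hA 0)
  obtain ⟨M, hM1, hM⟩ : ∃ M : ℝ, 1 ≤ M ∧ ∀ x, M < |x| → ψ x = 0 := by
    obtain ⟨r, hr⟩ := hc.isCompact.isBounded.subset_closedBall (0 : ℝ)
    refine ⟨max 1 r, le_max_left _ _, fun x hx => ?_⟩
    by_contra hne
    have := hr (subset_tsupport ψ hne)
    rw [mem_closedBall_zero_iff, Real.norm_eq_abs] at this
    linarith [le_max_right 1 r]
  have hpi : (0 : ℝ) < Real.pi⁻¹ := by positivity
  set I₀ : ℝ := ∫ h in Set.Ioi (0 : ℝ), (4 * A + B) * (1 + h ^ 2)⁻¹ with hI₀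
  have hI₀0 : 0 ≤ I₀ := integral_nonneg fun h => by positivity
  have hfirst (x : ℝ) : |absNabla ψ x| ≤ Real.pi⁻¹ * I₀ := by
    unfold absNabla
    rw [abs_mul, abs_of_pos hpi]
    gcongr
    rw [← Real.norm_eq_abs]
    refine norm_integral_le_of_norm_le
      ((integrable_inv_one_add_sq.const_mul _).integrableOn) ?_
    refine (ae_restrict_iff' measurableSet_Ioi).mpr (Filter.Eventually.of_forall fun h hh => ?_)
    have hh' : (0 : ℝ) < h := hh
    have h1 := hB x h hh'.le
    have h2 : |2 * ψ x - ψ (x + h) - ψ (x - h)| ≤ 4 * A := by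
      have a1 := abs_le.mp (hA x)
      have a2 := abs_le.mp (hA (x + h))
      have a3 := abs_le.mp (hA (x - h))
      rw [abs_le]
      constructor <;> linarith [a1.1, a1.2, a2.1, a2.2, a3.1, a3.2]
    rw [Real.norm_eq_abs, abs_div, abs_of_pos (by positivity : 0 < h ^ 2), ← div_eq_mul_inv,
      div_le_div_iff₀ (by positivity) (by positivity)]
    nlinarith [mul_le_mul_of_nonneg_right h2 (sq_nonneg h)]
  have hsecond (x : ℝ) (hx : 2 * M < |x|) :
      |absNabla ψ x| ≤ Real.pi⁻¹ * (2 * M * (8 * A / x ^ 2)) := by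
    have hx0 : 0 < |x| := by linarith
    have hx2 : 0 < x ^ 2 := by rw [← sq_abs]; positivity
    unfold absNabla
    rw [abs_mul, abs_of_pos hpi]
    gcongr
    rw [← Real.norm_eq_abs]
    have hint : IntegrableOn (fun _ : ℝ => 8 * A / x ^ 2) (Set.Icc (|x| - M) (|x| + M)) :=
      integrableOn_const (by simp)
    have hle := norm_integral_le_of_norm_le
      (f := fun h => (2 * ψ x - ψ (x + h) - ψ (x - h)) / h ^ 2)
      (μ := volume.restrict (Set.Ioi (0 : ℝ)))
      (g := (Set.Icc (|x| - M) (|x| + M)).indicator fun _ => 8 * A / x ^ 2)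
      ((integrable_indicator_iff measurableSet_Icc).mpr hint).integrableOn
      ((ae_restrict_iff' measurableSet_Ioi).mpr (Filter.Eventually.of_forall fun h hh => by
        have hh' : (0 : ℝ) < h := hh
        have hψx : ψ x = 0 := hM x (by linarith)
        by_cases hmem : h ∈ Set.Icc (|x| - M) (|x| + M)
        · rw [Set.indicator_of_mem hmem, Real.norm_eq_abs, abs_div,
            abs_of_pos (by positivity : 0 < h ^ 2), div_le_div_iff₀ (by positivity) hx2, hψx]
          have a2 := abs_le.mp (hA (x + h))
          have a3 := abs_le.mp (hA (x - h))
          have h2 : |2 * 0 - ψ (x + h) - ψ (x - h)| ≤ 2 * A := by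
            rw [abs_le]
            constructor <;> linarith [a2.1, a2.2, a3.1, a3.2]
          have h3 : x ^ 2 ≤ 4 * h ^ 2 := by
            rw [← sq_abs x]
            nlinarith [hmem.1]
          calc _ ≤ 2 * A * x ^ 2 := by gcongr
            _ ≤ 2 * A * (4 * h ^ 2) := by gcongr
            _ = _ := by ring
        · rw [Set.indicator_of_notMem hmem, hψx]
          have hout : M < |x + h| ∧ M < |x - h| := by
            have hne : M < |(|x| - h)| := by
              by_contra hcon
              have := abs_le.mp (not_lt.mp hcon)
              exact hmem ⟨by linarith [this.2], by linarith [this.1]⟩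
            rcases le_or_gt 0 x with h0 | h0
            · rw [abs_of_nonneg h0] at hne hx
              exact ⟨by rw [abs_of_pos (by linarith)]; linarith, hne⟩
            · rw [abs_of_neg h0] at hne hx
              refine ⟨?_, by rw [abs_of_neg (by linarith)]; linarith⟩
              rw [← abs_neg]
              convert hne using 2
              ring
          rw [hM _ hout.1, hM _ hout.2]
          simp))
    refine hle.trans ?_
    rw [integral_indicator measurableSet_Icc, Measure.restrict_restrict measurableSet_Icc,
      setIntegral_const]
    have hsub : Set.Icc (|x| - M) (|x| + M) ⊆ Set.Ioi 0 :=
      fun t ht => lt_of_lt_of_le (by linarith) ht.1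
    rw [Set.inter_eq_left.mpr hsub]
    rw [Real.volume_real_Icc_of_le (by linarith), smul_eq_mul]
    refine le_of_eq ?_
    ring
  refine ⟨max (Real.pi⁻¹ * I₀ * (1 + 4 * M ^ 2)) (Real.pi⁻¹ * (32 * M * A)), fun x => ?_⟩
  rcases le_or_gt |x| (2 * M) with hx | hx
  · refine le_trans ?_ (le_max_left _ _)
    have : x ^ 2 ≤ 4 * M ^ 2 := by rw [← sq_abs]; nlinarith [abs_nonneg x]
    gcongr
    exact hfirst x
  · refine le_trans ?_ (le_max_right _ _)
    have hx2 : 1 ≤ x ^ 2 := by rw [← sq_abs]; nlinarith [abs_nonneg x]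
    calc _ ≤ Real.pi⁻¹ * (2 * M * (8 * A / x ^ 2)) * (2 * x ^ 2) := by
          gcongr
          · exact hsecond x hx
          · linarith
      _ = _ := by
          have : x ≠ 0 := by rintro rfl; norm_num at hx2
          field_simp
          ring

lemma integrable_absNabla {φ : ℝ → ℝ} (hφ : MemLHalf φ) {ψ : ℝ → ℝ}
    (hψ : ContDiff ℝ (⊤ : ℕ∞) ψ) (hc : HasCompactSupport ψ) :
    Integrable fun x => φ x * absNabla ψ x := by
  obtain ⟨C, hC⟩ := absNabla_bound hψ hc
  refine hφ.mul (StronglyMeasurable.aestronglyMeasurable ?_) hC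
  unfold absNabla
  refine StronglyMeasurable.const_mul ?_ _
  refine StronglyMeasurable.integral_prod_right
    (f := fun x h => (2 * ψ x - ψ (x + h) - ψ (x - h)) / h ^ 2) ?_
  have hcont := hψ.continuous
  have h1 : Continuous fun p : ℝ × ℝ => 2 * ψ p.1 - ψ (p.1 + p.2) - ψ (p.1 - p.2) := by fun_prop
  have h2 : Continuous fun p : ℝ × ℝ => p.2 ^ 2 := by fun_prop
  exact (h1.measurable.div h2.measurable).stronglyMeasurable

lemma Lplus_congr (m : ℕ) {φ φ' : ℝ → ℝ} (h : φ =ᵐ[volume] φ') (ψ : ℝ → ℝ) :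
    Lplus m φ ψ = Lplus m φ' ψ := by
  unfold Lplus
  congr 1
  · exact integral_congr_ae (h.mono fun x hx => by simp only [hx])
  · exact integral_congr_ae (h.mono fun x hx => by simp only [hx])

lemma R_congr (m : ℕ) {φ φ' : ℝ → ℝ} (h : φ =ᵐ[volume] φ') : R m φ = R m φ' := by
  funext x
  unfold R
  congr 1
  exact integral_congr_ae (h.mono fun y hy => by simp only [hy])

lemma Lminus_congr (m : ℕ) {φ φ' : ℝ → ℝ} (h : φ =ᵐ[volume] φ') (ψ : ℝ → ℝ) :
    Lminus m φ ψ = Lminus m φ' ψ := by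
  unfold Lminus
  rw [Lplus_congr m h, R_congr m h]

lemma Lplus_add (m : ℕ) {φ φ' ψ : ℝ → ℝ} (h : MemLHalf φ) (h' : MemLHalf φ')
    (hψ : ContDiff ℝ (⊤ : ℕ∞) ψ) (hc : HasCompactSupport ψ) :
    Lplus m (φ + φ') ψ = Lplus m φ ψ + Lplus m φ' ψ := by
  have e1 := integral_add (integrable_absNabla h hψ hc) (integrable_absNabla h' hψ hc)
  have e2 := integral_add (integrable_potential (m := m) h hψ.continuous hc)
    (integrable_potential (m := m) h' hψ.continuous hc)
  simp only [Lplus, Pi.add_apply, add_mul, mul_add, e1, e2]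
  ring

lemma Lplus_smul (m : ℕ) (c : ℝ) (φ ψ : ℝ → ℝ) : Lplus m (c • φ) ψ = c * Lplus m φ ψ := by
  simp only [Lplus, Pi.smul_apply, smul_eq_mul, mul_sub]
  rw [← integral_const_mul, ← integral_const_mul]
  congr 1 <;> · congr 1; funext x; ring

lemma R_add (m : ℕ) {φ φ' : ℝ → ℝ} (h : MemLHalf φ) (h' : MemLHalf φ') :
    R m (φ + φ') = R m φ + R m φ' := by
  funext x
  have e := integral_add (integrable_kernel (m := m) h x) (integrable_kernel (m := m) h' x)
  simp only [R, Pi.add_apply, mul_add, e]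

lemma R_smul (m : ℕ) (c : ℝ) (φ : ℝ → ℝ) : R m (c • φ) = c • R m φ := by
  funext x
  simp only [R, Pi.smul_apply, smul_eq_mul, mul_left_comm _ c, integral_const_mul]

lemma Lminus_add (m : ℕ) {φ φ' ψ : ℝ → ℝ} (h : MemLHalf φ) (h' : MemLHalf φ')
    (hm : StronglyMeasurable φ) (hm' : StronglyMeasurable φ')
    (hψ : ContDiff ℝ (⊤ : ℕ∞) ψ) (hc : HasCompactSupport ψ) :
    Lminus m (φ + φ') ψ = Lminus m φ ψ + Lminus m φ' ψ := by
  have e := integral_add (integrable_R_mul (m := m) h hm hψ.continuous hc)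
    (integrable_R_mul (m := m) h' hm' hψ.continuous hc)
  simp only [Lminus, Lplus_add m h h' hψ hc, R_add m h h', Pi.add_apply, add_mul, e]
  ring

lemma Lminus_smul (m : ℕ) (c : ℝ) (φ ψ : ℝ → ℝ) : Lminus m (c • φ) ψ = c * Lminus m φ ψ := by
  simp only [Lminus, Lplus_smul, R_smul, Pi.smul_apply, smul_eq_mul, mul_assoc,
    integral_const_mul, mul_add]

lemma seminormSq_congr {φ φ' : ℝ → ℝ} (h : φ =ᵐ[volume] φ') :
    seminormSq φ = seminormSq φ' := by
  unfold seminormSq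
  congr 1
  refine lintegral_congr_ae ?_
  have h1 : ∀ᵐ p : ℝ × ℝ, φ p.1 = φ' p.1 := Measure.quasiMeasurePreserving_fst.ae h
  have h2 : ∀ᵐ p : ℝ × ℝ, φ p.2 = φ' p.2 := Measure.quasiMeasurePreserving_snd.ae h
  filter_upwards [h1, h2] with p hp1 hp2
  rw [hp1, hp2]

lemma seminormSq_add_lt_top {φ φ' : ℝ → ℝ} (hm : StronglyMeasurable φ)
    (h : seminormSq φ < ⊤) (h' : seminormSq φ' < ⊤) : seminormSq (φ + φ') < ⊤ := by
  have hc : ENNReal.ofReal (2 * Real.pi)⁻¹ ≠ 0 := by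
    rw [Ne, ENNReal.ofReal_eq_zero, not_le]; positivity
  have key (u : ℝ → ℝ) : seminormSq u < ⊤ ↔
      ∫⁻ p : ℝ × ℝ, ENNReal.ofReal (|u p.1 - u p.2| ^ 2 / |p.1 - p.2| ^ 2) < ⊤ := by
    unfold seminormSq
    rw [ENNReal.mul_lt_top_iff]
    simp only [ENNReal.ofReal_lt_top, true_and, hc, false_or]
    constructor
    · rintro (h | h)
      · exact h
      · rw [h]; exact ENNReal.zero_lt_top
    · exact Or.inl
  rw [key] at h h' ⊢
  have hmeas : Measurable fun p : ℝ × ℝ =>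
      ENNReal.ofReal (|φ p.1 - φ p.2| ^ 2 / |p.1 - p.2| ^ 2) := by
    have := hm.measurable
    refine ENNReal.measurable_ofReal.comp (Measurable.div ?_ ?_)
    · exact (((this.comp measurable_fst).sub (this.comp measurable_snd)).abs).pow_const 2
    · exact ((measurable_fst.sub measurable_snd).abs).pow_const 2
  have hle (p : ℝ × ℝ) :
      ENNReal.ofReal (|(φ + φ') p.1 - (φ + φ') p.2| ^ 2 / |p.1 - p.2| ^ 2) ≤
        2 * (ENNReal.ofReal (|φ p.1 - φ p.2| ^ 2 / |p.1 - p.2| ^ 2) +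
          ENNReal.ofReal (|φ' p.1 - φ' p.2| ^ 2 / |p.1 - p.2| ^ 2)) := by
    rw [← ENNReal.ofReal_add (by positivity) (by positivity),
      show (2 : ENNReal) = ENNReal.ofReal 2 by simp, ← ENNReal.ofReal_mul (by norm_num)]
    refine ENNReal.ofReal_le_ofReal ?_
    rw [← add_div, mul_div_assoc']
    gcongr
    simp only [Pi.add_apply, sq_abs]
    nlinarith [sq_nonneg ((φ p.1 - φ p.2) - (φ' p.1 - φ' p.2))]
  refine (lintegral_mono hle).trans_lt ?_
  rw [lintegral_const_mul' _ _ (by simp), lintegral_add_left hmeas]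
  exact ENNReal.mul_lt_top (by simp) (ENNReal.add_lt_top.mpr ⟨h, h'⟩)

lemma seminormSq_smul (c : ℝ) (φ : ℝ → ℝ) :
    seminormSq (c • φ) = ENNReal.ofReal (c ^ 2) * seminormSq φ := by
  unfold seminormSq
  rw [mul_left_comm, ← lintegral_const_mul' (ENNReal.ofReal (c ^ 2)) _ (by simp)]
  congr 1
  refine lintegral_congr fun p => ?_
  rw [← ENNReal.ofReal_mul (by positivity)]
  congr 1
  simp only [Pi.smul_apply, smul_eq_mul, sq_abs]
  ring

lemma MemLHalf.congr {φ φ' : ℝ → ℝ} (h : MemLHalf φ) (e : φ =ᵐ[volume] φ') : MemLHalf φ' :=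
  Integrable.congr h (e.mono fun x hx => by simp only [hx])

lemma MemLHalf.add {φ φ' : ℝ → ℝ} (h : MemLHalf φ) (h' : MemLHalf φ') : MemLHalf (φ + φ') := by
  refine (Integrable.add h h').congr (Filter.Eventually.of_forall fun x => ?_)
  simp [add_div]

lemma MemLHalf.smul {φ : ℝ → ℝ} (c : ℝ) (h : MemLHalf φ) : MemLHalf (c • φ) := by
  refine (Integrable.const_mul h c).congr (Filter.Eventually.of_forall fun x => ?_)
  simp [mul_div_assoc]

/-! ### The spaces -/

/-- `Ḣ^{1/2}(ℝ)`: the (classes of) real-valued `φ ∈ L_{1/2}(ℝ)` with `‖φ‖_{Ḣ^{1/2}} < ∞`. -/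
def HdotHalf : Submodule ℝ (ℝ →ₘ[volume] ℝ) where
  carrier := {φ | MemLHalf φ ∧ seminormSq φ < ⊤}
  zero_mem' := by
    have e : ((0 : ℝ →ₘ[volume] ℝ) : ℝ → ℝ) =ᵐ[volume] (0 : ℝ → ℝ) := AEEqFun.coeFn_zero
    refine ⟨MemLHalf.congr ?_ e.symm, ?_⟩
    · simp [MemLHalf]
    · rw [seminormSq_congr e]; simp [seminormSq]
  add_mem' := by
    rintro φ φ' ⟨h1, h2⟩ ⟨h1', h2'⟩
    have e := AEEqFun.coeFn_add φ φ'
    refine ⟨(h1.add h1').congr e.symm, ?_⟩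
    rw [seminormSq_congr e]
    exact seminormSq_add_lt_top φ.stronglyMeasurable h2 h2'
  smul_mem' := by
    rintro c φ ⟨h1, h2⟩
    have e := AEEqFun.coeFn_smul c φ
    refine ⟨(h1.smul c).congr e.symm, ?_⟩
    rw [seminormSq_congr e, seminormSq_smul]
    exact ENNReal.mul_lt_top (by simp) h2

/-- `𝒩(L₊) = {φ ∈ Ḣ^{1/2}(ℝ) : L₊ φ = 0}`, the equation being understood in `𝒟'(ℝ)`. -/
def NLplus (m : ℕ) : Submodule ℝ (ℝ →ₘ[volume] ℝ) where
  carrier := {φ | φ ∈ HdotHalf ∧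
    ∀ ψ : ℝ → ℝ, ContDiff ℝ (⊤ : ℕ∞) ψ → HasCompactSupport ψ → Lplus m φ ψ = 0}
  zero_mem' := by
    refine ⟨HdotHalf.zero_mem, fun ψ _ _ => ?_⟩
    have e : ((0 : ℝ →ₘ[volume] ℝ) : ℝ → ℝ) =ᵐ[volume] (0 : ℝ → ℝ) := AEEqFun.coeFn_zero
    rw [Lplus_congr m e]
    simp [Lplus]
  add_mem' := by
    rintro φ φ' ⟨h, e⟩ ⟨h', e'⟩
    refine ⟨HdotHalf.add_mem h h', fun ψ hψ hc => ?_⟩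
    rw [Lplus_congr m (AEEqFun.coeFn_add φ φ'), Lplus_add m h.1 h'.1 hψ hc, e ψ hψ hc,
      e' ψ hψ hc, add_zero]
  smul_mem' := by
    rintro c φ ⟨h, e⟩
    refine ⟨HdotHalf.smul_mem c h, fun ψ hψ hc => ?_⟩
    rw [Lplus_congr m (AEEqFun.coeFn_smul c φ), Lplus_smul, e ψ hψ hc, mul_zero]

/-- `𝒩(L₋) = {φ ∈ Ḣ^{1/2}(ℝ) : L₋ φ = 0}`, the equation being understood in `𝒟'(ℝ)`. -/
def NLminus (m : ℕ) : Submodule ℝ (ℝ →ₘ[volume] ℝ) where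
  carrier := {φ | φ ∈ HdotHalf ∧
    ∀ ψ : ℝ → ℝ, ContDiff ℝ (⊤ : ℕ∞) ψ → HasCompactSupport ψ → Lminus m φ ψ = 0}
  zero_mem' := by
    refine ⟨HdotHalf.zero_mem, fun ψ _ _ => ?_⟩
    have e : ((0 : ℝ →ₘ[volume] ℝ) : ℝ → ℝ) =ᵐ[volume] (0 : ℝ → ℝ) := AEEqFun.coeFn_zero
    rw [Lminus_congr m e]
    simp [Lminus, Lplus, R]
  add_mem' := by
    rintro φ φ' ⟨h, e⟩ ⟨h', e'⟩
    refine ⟨HdotHalf.add_mem h h', fun ψ hψ hc => ?_⟩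
    rw [Lminus_congr m (AEEqFun.coeFn_add φ φ'),
      Lminus_add m h.1 h'.1 φ.stronglyMeasurable φ'.stronglyMeasurable hψ hc, e ψ hψ hc,
      e' ψ hψ hc, add_zero]
  smul_mem' := by
    rintro c φ ⟨h, e⟩
    refine ⟨HdotHalf.smul_mem c h, fun ψ hψ hc => ?_⟩
    rw [Lminus_congr m (AEEqFun.coeFn_smul c φ), Lminus_smul, e ψ hψ hc, mul_zero]

/-- `f_k` as a class of functions modulo null sets. -/
def fClass (k : ℕ) : ℝ →ₘ[volume] ℝ := AEEqFun.mk (f k) (continuous_f k).aestronglyMeasurable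

/-- `g_k` as a class of functions modulo null sets. -/
def gClass (k : ℕ) : ℝ →ₘ[volume] ℝ := AEEqFun.mk (g k) (continuous_g k).aestronglyMeasurable

/-- Nondegeneracy of the linearized operator `L = diag(L₊, L₋)` around `Q_m`: the nullspaces
have exactly the dimensions `2` and `2m + 1` that are forced by the symmetries and by the
number of free parameters of the half-harmonic maps of degree `m`. -/
def Nondegenerate (m : ℕ) : Prop :=
  Module.finrank ℝ (NLplus m) = 2 ∧ Module.finrank ℝ (NLminus m) = 2 * m + 1

/-- `φ` is a resonance for an operator with nullspace `N` in `Ḣ^{1/2}`: it belongs to `N`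
but not to `L²(ℝ)`. -/
def IsResonance (N : Submodule ℝ (ℝ →ₘ[volume] ℝ)) (φ : ℝ →ₘ[volume] ℝ) : Prop :=
  φ ∈ N ∧ φ ∈ HdotHalf ∧ φ ∉ Lp ℝ 2 (volume : Measure ℝ)

end HalfHarmonic

end

noncomputable section

namespace HalfHarmonic

open Filter Topology

/-! The map `z` carries the line conformally onto the circle minus the point `i`, with factor `w`.
In this coordinate all three operators are diagonal on the functions `mode ℓ k`, the real parts or
other real-linear images of `z ^ k`: `|∇|` multiplies by `k w` (`energy_mode`), the potential `|∂ₓ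
Q_m|` is `m w` (`norm_deriv_Q`), and `R` multiplies by `(m - k)₊ w` (`R_mode`). On frequency `k`,
then, `L₊` acts as `(k - m) w` and `L₋` as `(k - m + (m - k)₊) w`. The first factor vanishes exactly
for `k = m`, the second exactly for `k ≤ m`, which accounts for the dimensions `2` and `2m + 1`.

To make this rigorous for an arbitrary `φ` in `Ḣ^{1/2}`, the distributional pairing is rewritten as
a symmetric double integral (`integral_mul_absNabla`), and the eigenvalue `k` is obtained by
regularizing the chordal kernel `‖z x - z y‖⁻²` to a Poisson kernel and letting `r` tend to `1`.

The equations are tested only against compactly supported functions, which vanish near the point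
`i`, so `mode ℓ k` is not admissible. After subtracting its value `ℓ (i ^ k)` at infinity it is a
limit of test functions (`exists_test_sequence`). The energy does not see the subtracted constant,
but the other terms do. For `L₊` this leaves a multiple of the mean `∫ w φ`, and the equation at `k
= m` forces that mean to vanish because `i ^ m ≠ 0` (`Lplus_coeff`, `coeff_eq_zero_of_mem_NLplus`).
For `L₋` the contributions of the potential and of `R` cancel (`Lminus_coeff`).

Thus all but finitely many Fourier coefficients of `φ` vanish. Since trigonometric polynomials
determine finite measures (`ae_eq_zero_of_integral_mul_eq_zero`), `φ` is a finite combination of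
modes. A mode has the limit `ℓ (i ^ m)` at infinity, so it leaves `L²` when this is nonzero: the
imaginary part for odd `m`, the real part for even `m`. -/

/-! ### The circle in the stereographic coordinate. -/

/-- The density `2 / (1 + x²)` of the arc length of the circle in the coordinate `x`. -/
def w (x : ℝ) : ℝ := 2 / (1 + x ^ 2)

lemma w_pos (x : ℝ) : 0 < w x := by unfold w; positivity

lemma continuous_w : Continuous w := by
  unfold w
  refine continuous_const.div (by fun_prop) fun x => by positivity

lemma integrable_w : Integrable w := by
  refine (integrable_inv_one_add_sq.const_mul 2).congr (Eventually.of_forall fun x => ?_)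
  simp [w, div_eq_mul_inv]

lemma integral_w : ∫ x, w x = 2 * Real.pi := by
  simp only [w, div_eq_mul_inv]
  rw [integral_const_mul, integral_univ_inv_one_add_sq]

/-- Conformality in integrated form: it trades the kernel `|x - y|⁻² dx dy` for the chordal kernel
with respect to `w x w y dx dy`. -/
lemma norm_z_sub_sq (x y : ℝ) : ‖z x - z y‖ ^ 2 = (x - y) ^ 2 * (w x * w y) := by
  rw [norm_z_sub, sq_abs]
  unfold w
  field_simp
  ring

lemma ofReal_add_I_ne_zero (x : ℝ) : (x : ℂ) + Complex.I ≠ 0 := by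
  intro h
  have := congrArg Complex.im h
  simp at this

lemma z_ne_zero (x : ℝ) : z x ≠ 0 := by
  intro h
  have := norm_z x
  simp [h] at this

lemma conj_z (x : ℝ) : (starRingEnd ℂ) (z x) = (z x)⁻¹ := by
  rw [Complex.inv_def, Complex.normSq_eq_norm_sq, norm_z]
  simp

lemma norm_z_zpow (x : ℝ) (n : ℤ) : ‖z x ^ n‖ = 1 := by
  rw [norm_zpow, norm_z, one_zpow]

lemma z_injective : Function.Injective z := by
  intro x y h
  have := norm_z_sub_sq x y
  rw [h, sub_self, norm_zero] at this
  have h2 : (x - y) ^ 2 = 0 := by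
    have hw : w x * w y ≠ 0 := (mul_pos (w_pos x) (w_pos y)).ne'
    have h0 : (x - y) ^ 2 * (w x * w y) = 0 := by rw [← this]; norm_num
    exact (mul_eq_zero.mp h0).resolve_right hw
  exact sub_eq_zero.mp (pow_eq_zero_iff (by norm_num) |>.mp h2)

lemma hasDerivAt_z (x : ℝ) : HasDerivAt z (Complex.I * w x * z x) x := by
  have hx : HasDerivAt (fun x : ℝ => (x : ℂ)) 1 x := Complex.ofRealCLM.hasDerivAt
  have hne := ofReal_add_I_ne_zero x
  have h := ((hx.sub_const Complex.I).div (hx.add_const Complex.I) hne).const_mul Complex.I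
  refine h.congr_deriv ?_
  have h1 : (1 + (x : ℂ) ^ 2) = ((x : ℂ) + Complex.I) * ((x : ℂ) - Complex.I) := by
    linear_combination Complex.I_sq
  have h2 : (x : ℂ) - Complex.I ≠ 0 := by
    intro h
    have := congrArg Complex.im h
    simp at this
  unfold w z
  push_cast
  rw [h1]
  field_simp
  ring_nf

lemma hasDerivAt_z_zpow (n : ℤ) (x : ℝ) :
    HasDerivAt (fun x => z x ^ n) (Complex.I * n * (w x * z x ^ n)) x := by
  have h := (hasDerivAt_zpow n (z x) (Or.inl (z_ne_zero x))).comp x (hasDerivAt_z x)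
  refine h.congr_deriv ?_
  have := z_ne_zero x
  rw [zpow_sub_one₀ this]
  field_simp

lemma continuous_z_zpow (n : ℤ) : Continuous fun x => z x ^ n :=
  continuous_iff_continuousAt.mpr fun x => (hasDerivAt_z_zpow n x).continuousAt

/-- The point `i` is the one missed by `z`; both ends of the line close up there. -/
lemma tendsto_z_cocompact : Tendsto z (cocompact ℝ) (𝓝 Complex.I) := by
  rw [tendsto_iff_norm_sub_tendsto_zero]
  have h : ∀ x, ‖z x - Complex.I‖ = 2 * ‖(x : ℂ) + Complex.I‖⁻¹ := by
    intro x
    have hne := ofReal_add_I_ne_zero x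
    have : z x - Complex.I = 2 * ((x : ℂ) + Complex.I)⁻¹ := by
      unfold z
      field_simp
      linear_combination -2 * Complex.I_sq
    rw [this, norm_mul, norm_inv]
    norm_num
  simp only [h]
  have h1 : Tendsto (fun x : ℝ => ‖(x : ℂ) + Complex.I‖) (cocompact ℝ) atTop := by
    refine tendsto_atTop_mono (f := fun x : ℝ => ‖x‖) (fun x => ?_) (tendsto_norm_cocompact_atTop)
    have := Complex.abs_re_le_norm ((x : ℂ) + Complex.I)
    simpa using this
  simpa using (tendsto_inv_atTop_zero.comp h1).const_mul 2

lemma integrable_w_mul_zpow (n : ℤ) : Integrable fun x => (w x : ℂ) * z x ^ n := by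
  refine (integrable_w.ofReal (𝕜 := ℂ)).mul_bdd (c := 1) (continuous_z_zpow n).aestronglyMeasurable
    (Eventually.of_forall fun x => (norm_z_zpow x n).le)

/-- For `n ≠ 0` the integrand is, up to the factor `i n`, the derivative of `z ^ n`, which has the
same limit at both ends of the line. -/
lemma integral_w_mul_zpow (n : ℤ) :
    ∫ x, (w x : ℂ) * z x ^ n = if n = 0 then 2 * (Real.pi : ℂ) else 0 := by
  split_ifs with hn
  · subst hn
    have := integral_ofReal (𝕜 := ℂ) (f := w) (μ := volume)
    rw [integral_w] at this
    simpa using this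
  · have hlim : Tendsto (fun x => z x ^ n) (cocompact ℝ) (𝓝 (Complex.I ^ n)) :=
      (continuousAt_zpow₀ _ n (Or.inl Complex.I_ne_zero)).tendsto.comp tendsto_z_cocompact
    have h := integral_of_hasDerivAt_of_tendsto (hasDerivAt_z_zpow n)
      ((integrable_w_mul_zpow n).const_mul _)
      (hlim.mono_left atBot_le_cocompact) (hlim.mono_left atTop_le_cocompact)
    rw [integral_const_mul, sub_self] at h
    have hc : Complex.I * (n : ℂ) ≠ 0 := mul_ne_zero Complex.I_ne_zero (by exact_mod_cast hn)
    exact (mul_eq_zero.mp h).resolve_left hc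

/-! ### The potential and the operator `R` on powers of `z`. -/

lemma norm_deriv_Q (m : ℕ) (x : ℝ) : ‖deriv (Q m) x‖ = m * w x := by
  have hz : HasDerivAt (fun x => z x ^ m) (Complex.I * m * (w x * z x ^ m)) x := by
    simpa using hasDerivAt_z_zpow (m : ℤ) x
  set d := Complex.I * m * (w x * z x ^ m) with hd
  have hf : HasDerivAt (f m) d.re x := Complex.reCLM.hasFDerivAt.comp_hasDerivAt x hz
  have hg : HasDerivAt (g m) d.im x := Complex.imCLM.hasFDerivAt.comp_hasDerivAt x hz
  have hQ : HasDerivAt (fun x => (![f m x, g m x, 0] : Fin 3 → ℝ)) ![d.re, d.im, 0] x := by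
    rw [hasDerivAt_pi]
    intro i
    fin_cases i
    · exact hf
    · exact hg
    · exact hasDerivAt_const x (0 : ℝ)
  have hQ' : HasDerivAt (Q m) !₂[d.re, d.im, 0] x :=
    (PiLp.continuousLinearEquiv 2 ℝ (fun _ : Fin 3 =>
      ℝ)).symm.toContinuousLinearMap.hasFDerivAt.comp_hasDerivAt x hQ
  rw [hQ'.deriv, EuclideanSpace.norm_eq]
  simp only [Fin.sum_univ_three]
  have : ‖d‖ = m * w x := by
    rw [hd]
    simp [norm_z, abs_of_pos (w_pos x)]
  rw [← this, Complex.norm_eq_sqrt_sq_add_sq]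
  congr 1
  simp

lemma kernel_comm (m : ℕ) (x y : ℝ) : kernel m x y = kernel m y x := by
  unfold kernel
  rw [norm_sub_rev, abs_sub_comm]

/-- Factoring `z x - z y` out of `z x ^ m - z y ^ m` cancels the singularity and leaves the squared
modulus of a geometric sum, expanded using `conj z = z⁻¹`. On the diagonal the quotient takes the
default value `0`, hence `x ≠ y`. -/
lemma kernel_eq_sum (m : ℕ) {x y : ℝ} (hxy : x ≠ y) :
    (kernel m x y : ℂ) = w x * w y * ∑ j ∈ Finset.range m, ∑ l ∈ Finset.range m,
      z x ^ ((j : ℤ) - l) * z y ^ ((l : ℤ) - j) := by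
  have hzne : z x - z y ≠ 0 := sub_ne_zero.mpr fun h => hxy (z_injective h)
  have hx := z_ne_zero x
  have hy := z_ne_zero y
  set S := ∑ j ∈ Finset.range m, z x ^ j * z y ^ (m - 1 - j) with hS
  have hgeom : S * (z x - z y) = z x ^ m - z y ^ m := (Commute.all _ _).geom_sum₂_mul m
  have hk : kernel m x y = w x * w y * ‖S‖ ^ 2 := by
    have hd : (x - y) ^ 2 ≠ 0 := pow_ne_zero 2 (sub_ne_zero.mpr hxy)
    unfold kernel
    rw [norm_Q_sub, ← hgeom, norm_mul, mul_pow, norm_z_sub_sq, sq_abs]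
    field_simp
  rw [hk]
  push_cast
  congr 1
  rw [← Complex.conj_mul', mul_comm, hS, map_sum, Finset.sum_mul_sum]
  refine Finset.sum_congr rfl fun j hj => Finset.sum_congr rfl fun l hl => ?_
  have hj' := Finset.mem_range.mp hj
  have hl' := Finset.mem_range.mp hl
  rw [map_mul, map_pow, map_pow, conj_z, conj_z, zpow_sub₀ hx, zpow_sub₀ hy]
  have e1 : z y ^ (m - 1 - j) * z y ^ j = z y ^ (m - 1) := by rw [← pow_add]; congr 1; omega
  have e2 : z y ^ (m - 1 - l) * z y ^ l = z y ^ (m - 1) := by rw [← pow_add]; congr 1; omega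
  simp only [inv_pow, zpow_natCast]
  field_simp
  rw [e2, e1]

/-- Orthogonality keeps only the pairs with `j = l + k`. There are `m - k` of them, with truncated
subtraction: none once `k ≥ m`. -/
lemma integral_kernel_mul_pow (m k : ℕ) (x : ℝ) :
    ∫ y, (kernel m x y : ℂ) * z y ^ k = 2 * Real.pi * ((m - k : ℕ) * w x * z x ^ k) := by
  have hae : ∀ᵐ y : ℝ, y ≠ x := by simp [ae_iff]
  have h1 : ∫ y, (kernel m x y : ℂ) * z y ^ k =
      ∫ y, ∑ j ∈ Finset.range m, ∑ l ∈ Finset.range m,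
        w x * z x ^ ((j : ℤ) - l) * (w y * z y ^ ((l : ℤ) - j + k)) := by
    refine integral_congr_ae (hae.mono fun y hy => ?_)
    simp only
    rw [kernel_eq_sum m (Ne.symm hy), mul_assoc, Finset.sum_mul, Finset.mul_sum]
    refine Finset.sum_congr rfl fun j _ => ?_
    rw [Finset.sum_mul, Finset.mul_sum]
    refine Finset.sum_congr rfl fun l _ => ?_
    rw [zpow_add₀ (z_ne_zero y), zpow_natCast]
    ring
  rw [h1, integral_finsetSum _ fun j _ => integrable_finsetSum _ fun l _ =>
    (integrable_w_mul_zpow _).const_mul _]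
  have h2 (j : ℕ) : ∫ y, ∑ l ∈ Finset.range m,
      w x * z x ^ ((j : ℤ) - l) * (w y * z y ^ ((l : ℤ) - j + k)) =
      ∑ l ∈ Finset.range m, if j = l + k then 2 * Real.pi * (w x * z x ^ k) else 0 := by
    rw [integral_finsetSum _ fun l _ => (integrable_w_mul_zpow _).const_mul _]
    refine Finset.sum_congr rfl fun l _ => ?_
    rw [integral_const_mul, integral_w_mul_zpow]
    by_cases h : j = l + k
    · subst h
      have e1 : (l : ℤ) - (l + k : ℕ) + k = 0 := by push_cast; ring
      have e2 : ((l + k : ℕ) : ℤ) - l = k := by push_cast; ring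
      rw [if_pos e1, if_pos rfl, e2, zpow_natCast]
      ring
    · rw [if_neg h, if_neg (by omega), mul_zero]
  simp only [h2]
  rw [Finset.sum_comm]
  simp only [Finset.sum_ite_eq', Finset.mem_range]
  rw [← Finset.sum_filter, Finset.sum_const, nsmul_eq_mul]
  have hcard : ((Finset.range m).filter fun l => l + k < m).card = m - k := by
    have : ((Finset.range m).filter fun l => l + k < m) = Finset.range (m - k) := by
      ext l
      simp only [Finset.mem_filter, Finset.mem_range]
      omega
    rw [this, Finset.card_range]
  rw [hcard]
  ring

/-- The function `ℓ (z ^ k)`; `f k` and `g k` are the cases `ℓ = Re` and `ℓ = Im`. -/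
def mode (ℓ : ℂ →L[ℝ] ℝ) (k : ℕ) (x : ℝ) : ℝ := ℓ (z x ^ k)

lemma f_eq_mode (k : ℕ) : f k = mode Complex.reCLM k := rfl

lemma g_eq_mode (k : ℕ) : g k = mode Complex.imCLM k := rfl

lemma continuous_mode (ℓ : ℂ →L[ℝ] ℝ) (k : ℕ) : Continuous (mode ℓ k) :=
  ℓ.continuous.comp (continuous_z.pow k)

lemma abs_mode_le (ℓ : ℂ →L[ℝ] ℝ) (k : ℕ) (x : ℝ) : |mode ℓ k x| ≤ ‖ℓ‖ := by
  have := ℓ.le_opNorm (z x ^ k)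
  rwa [norm_pow, norm_z, one_pow, mul_one] at this

lemma abs_mode_sub_le (ℓ : ℂ →L[ℝ] ℝ) (k : ℕ) (x y : ℝ) :
    |mode ℓ k x - mode ℓ k y| ≤ ‖ℓ‖ * k * ‖z x - z y‖ := by
  have := ℓ.le_opNorm (z x ^ k - z y ^ k)
  rw [map_sub] at this
  refine this.trans ?_
  rw [mul_assoc]
  gcongr
  exact norm_pow_sub_le (norm_z x) (norm_z y) k

lemma tendsto_mode_cocompact (ℓ : ℂ →L[ℝ] ℝ) (k : ℕ) :
    Tendsto (mode ℓ k) (cocompact ℝ) (𝓝 (ℓ (Complex.I ^ k))) :=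
  (ℓ.continuous.tendsto _).comp (tendsto_z_cocompact.pow k)

lemma kernel_le_w_mul_w (m : ℕ) (x y : ℝ) : kernel m x y ≤ (m : ℝ) ^ 2 * (w x * w y) := by
  rcases eq_or_ne x y with rfl | hxy
  · simp only [kernel, sub_self, abs_zero]
    have := w_pos x
    norm_num
    positivity
  · have h1 : ‖z x ^ m - z y ^ m‖ ^ 2 ≤ (m * ‖z x - z y‖) ^ 2 :=
      pow_le_pow_left₀ (norm_nonneg _) (norm_pow_sub_le (norm_z x) (norm_z y) m) 2
    have hd : 0 < (x - y) ^ 2 := by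
      have := sub_ne_zero.mpr hxy
      positivity
    unfold kernel
    rw [norm_Q_sub, sq_abs, div_le_iff₀ hd]
    rw [mul_pow, norm_z_sub_sq] at h1
    linarith

lemma R_mode (m : ℕ) (ℓ : ℂ →L[ℝ] ℝ) (k : ℕ) (x : ℝ) :
    R m (mode ℓ k) x = (m - k : ℕ) * (w x * mode ℓ k x) := by
  have hint : Integrable fun y => (kernel m x y : ℂ) * z y ^ k := by
    have hk : Integrable fun y => kernel m x y := by
      refine (integrable_w.const_mul ((m : ℝ) ^ 2 * w x)).mono'
        ((measurable_kernel m).comp measurable_prodMk_left).aestronglyMeasurable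
        (Eventually.of_forall fun y => ?_)
      rw [Real.norm_eq_abs, abs_of_nonneg (kernel_nonneg m x y)]
      exact (kernel_le_w_mul_w m x y).trans_eq (by ring)
    refine (hk.ofReal (𝕜 := ℂ)).mul_bdd (c := 1) (continuous_z.pow k).aestronglyMeasurable
      (Eventually.of_forall fun y => ?_)
    rw [norm_pow, norm_z, one_pow]
  have h := ℓ.integral_comp_comm hint
  have smul_eq (c : ℝ) (u : ℂ) : ℓ (c * u) = c * ℓ u := by
    rw [← Complex.real_smul, map_smul, smul_eq_mul]
  simp only [smul_eq] at h
  unfold R mode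
  rw [h, integral_kernel_mul_pow]
  have e : (2 * (Real.pi : ℂ) * ((m - k : ℕ) * w x * z x ^ k)) =
      ((2 * Real.pi * ((m - k : ℕ) * w x) : ℝ) : ℂ) * z x ^ k := by
    push_cast; ring
  rw [e, smul_eq]
  have := Real.pi_pos
  field_simp

/-! ### The energy form and difference quotients. -/

/-- The difference quotient of `φ`. -/
def diffQuot (φ : ℝ → ℝ) (p : ℝ × ℝ) : ℝ := (φ p.1 - φ p.2) / (p.1 - p.2)

/-- The bilinear form of `|∇|` on `Ḣ^{1/2}(ℝ)`. -/
def energy (φ ψ : ℝ → ℝ) : ℝ := (2 * Real.pi)⁻¹ * ∫ p : ℝ × ℝ, diffQuot φ p * diffQuot ψ p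

lemma energy_comm (φ ψ : ℝ → ℝ) : energy φ ψ = energy ψ φ := by
  unfold energy
  simp only [mul_comm]

lemma measurable_diffQuot {φ : ℝ → ℝ} (hφ : Measurable φ) : Measurable (diffQuot φ) :=
  ((hφ.comp measurable_fst).sub (hφ.comp measurable_snd)).div (measurable_fst.sub measurable_snd)

/-- As an `L²` condition on the plane, finiteness of the seminorm makes the energy form well defined
by Hölder's inequality. -/
lemma seminormSq_lt_top_iff {φ : ℝ → ℝ} (hφ : Measurable φ) :
    seminormSq φ < ⊤ ↔ MemLp (diffQuot φ) 2 := by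
  have hc : ENNReal.ofReal (2 * Real.pi)⁻¹ ≠ 0 := by
    rw [Ne, ENNReal.ofReal_eq_zero, not_le]; positivity
  have hm := measurable_diffQuot hφ
  have hsq (p : ℝ × ℝ) : ENNReal.ofReal (|φ p.1 - φ p.2| ^ 2 / |p.1 - p.2| ^ 2) =
      ‖diffQuot φ p ^ 2‖ₑ := by
    rw [Real.enorm_eq_ofReal (by positivity)]
    simp only [diffQuot, div_pow, sq_abs]
  rw [memLp_two_iff_integrable_sq hm.aestronglyMeasurable, Integrable, HasFiniteIntegral]
  unfold seminormSq
  simp only [hsq, (hm.pow_const 2).aestronglyMeasurable, true_and]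
  rw [ENNReal.mul_lt_top_iff]
  simp only [ENNReal.ofReal_lt_top, true_and, hc, false_or]
  constructor
  · rintro (h | h)
    · exact h
    · rw [h]; exact ENNReal.zero_lt_top
  · exact Or.inl

lemma integrable_diffQuot_mul {φ ψ : ℝ → ℝ} (hφ : MemLp (diffQuot φ) 2)
    (hψ : MemLp (diffQuot ψ) 2) : Integrable fun p => diffQuot φ p * diffQuot ψ p :=
  hφ.integrable_mul hψ

/-- A function that is Lipschitz for the chordal distance has a difference quotient dominated by
`√(w w)`, which is square integrable because `w` is integrable. -/
lemma abs_diffQuot_le {ψ : ℝ → ℝ} {C : ℝ} (h : ∀ x y, |ψ x - ψ y| ≤ C * ‖z x - z y‖)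
    (p : ℝ × ℝ) : |diffQuot ψ p| ≤ C * √(w p.1 * w p.2) := by
  have hC : 0 ≤ C := by
    have h1 := (abs_nonneg _).trans (h 0 1)
    have h2 : 0 < ‖z 0 - z 1‖ := norm_pos_iff.mpr (sub_ne_zero.mpr fun e => by
      simpa using z_injective e)
    exact nonneg_of_mul_nonneg_left h1 h2
  unfold diffQuot
  rcases eq_or_ne p.1 p.2 with e | e
  · simp only [e, sub_self, div_zero, abs_zero]
    positivity
  · have hd : 0 < |p.1 - p.2| := abs_pos.mpr (sub_ne_zero.mpr e)
    have hn : ‖z p.1 - z p.2‖ = |p.1 - p.2| * √(w p.1 * w p.2) := by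
      rw [← Real.sqrt_sq (norm_nonneg _), norm_z_sub_sq, Real.sqrt_mul (sq_nonneg _),
        Real.sqrt_sq_eq_abs]
    rw [abs_div, div_le_iff₀ hd]
    refine (h _ _).trans_eq ?_
    rw [hn]
    ring

lemma memLp_sqrt_w_mul_w : MemLp (fun p : ℝ × ℝ => √(w p.1 * w p.2)) 2 := by
  have hc : Continuous fun p : ℝ × ℝ => √(w p.1 * w p.2) :=
    ((continuous_w.comp continuous_fst).mul (continuous_w.comp continuous_snd)).sqrt
  rw [memLp_two_iff_integrable_sq hc.aestronglyMeasurable]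
  refine (integrable_w.mul_prod integrable_w).congr (Eventually.of_forall fun p => ?_)
  simp only
  rw [Real.sq_sqrt (mul_pos (w_pos _) (w_pos _)).le]

lemma memLp_diffQuot_of_chordal {ψ : ℝ → ℝ} (hψ : Measurable ψ) {C : ℝ}
    (h : ∀ x y, |ψ x - ψ y| ≤ C * ‖z x - z y‖) : MemLp (diffQuot ψ) 2 :=
  (memLp_sqrt_w_mul_w.const_mul C).mono' (measurable_diffQuot hψ).aestronglyMeasurable
    (Eventually.of_forall fun p => abs_diffQuot_le h p)

/-! ### The distribution `|∇| φ` as an energy. -/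

/-- A Peetre-type inequality: it moves the weight `1 + x²` to a translate of `x` at the cost of `1 +
h²`. -/
lemma one_add_sq_le (x h : ℝ) : 1 + x ^ 2 ≤ 2 * ((1 + (x + h) ^ 2) * (1 + h ^ 2)) := by
  nlinarith [sq_nonneg (x + 2 * h), sq_nonneg ((x + h) * h)]

lemma exists_support_bound {ψ : ℝ → ℝ} (hc : HasCompactSupport ψ) :
    ∃ M : ℝ, 0 ≤ M ∧ ∀ x, M < |x| → ψ x = 0 := by
  obtain ⟨r, hr⟩ := hc.isCompact.isBounded.subset_closedBall (0 : ℝ)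
  refine ⟨max 0 r, le_max_left _ _, fun x hx => ?_⟩
  by_contra hne
  have := hr (subset_tsupport ψ hne)
  rw [mem_closedBall_zero_iff, Real.norm_eq_abs] at this
  linarith [le_max_right 0 r]

/-- With one point in the support, its weight is bounded and the weight of the other is at most of
order `1 + (x - y)²`. The Lipschitz bound absorbs the `1` and the sup bound absorbs `(x - y)²`. -/
lemma exists_chordal_bound {ψ : ℝ → ℝ} (hψ : ContDiff ℝ (⊤ : ℕ∞) ψ) (hc : HasCompactSupport ψ) :
    ∃ C, ∀ x y, |ψ x - ψ y| ≤ C * ‖z x - z y‖ := by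
  obtain ⟨M, hM0, hM⟩ := exists_support_bound hc
  obtain ⟨A, hA⟩ := hc.exists_bound_of_continuous hψ.continuous
  simp only [Real.norm_eq_abs] at hA
  obtain ⟨K, hK⟩ := hψ.lipschitzWith_of_hasCompactSupport hc (by simp)
  have key (x y : ℝ) (hx : |x| ≤ M) :
      (ψ x - ψ y) ^ 2 ≤ (1 + M ^ 2) ^ 2 * (K ^ 2 + 4 * A ^ 2) * ‖z x - z y‖ ^ 2 := by
    have h1 : (ψ x - ψ y) ^ 2 ≤ K ^ 2 * (x - y) ^ 2 := by
      have := hK.dist_le_mul x y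
      rw [Real.dist_eq, Real.dist_eq] at this
      rw [← sq_abs (ψ x - ψ y), ← sq_abs (x - y), ← mul_pow]
      exact pow_le_pow_left₀ (abs_nonneg _) this 2
    have h2 : (ψ x - ψ y) ^ 2 ≤ 4 * A ^ 2 := by
      have : |ψ x - ψ y| ≤ 2 * A := (abs_sub _ _).trans (by linarith [hA x, hA y])
      rw [← sq_abs]
      nlinarith [abs_nonneg (ψ x - ψ y)]
    have h3 : 1 + x ^ 2 ≤ 1 + M ^ 2 := by
      rw [← sq_abs]; nlinarith [abs_nonneg x]
    have h4 := one_add_sq_le y (x - y)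
    rw [show y + (x - y) = x by ring] at h4
    have h5 : (ψ x - ψ y) ^ 2 * (1 + (x - y) ^ 2) ≤ (K ^ 2 + 4 * A ^ 2) * (x - y) ^ 2 := by
      nlinarith [mul_le_mul_of_nonneg_right h2 (sq_nonneg (x - y))]
    have h6 : (ψ x - ψ y) ^ 2 * ((1 + x ^ 2) * (1 + y ^ 2)) ≤
        (1 + M ^ 2) ^ 2 * (K ^ 2 + 4 * A ^ 2) * (4 * (x - y) ^ 2) := by
      calc _ ≤ (ψ x - ψ y) ^ 2 * ((1 + x ^ 2) * (2 * ((1 + x ^ 2) * (1 + (x - y) ^ 2)))) := by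
            gcongr
        _ = 2 * ((1 + x ^ 2) * (1 + x ^ 2)) * ((ψ x - ψ y) ^ 2 * (1 + (x - y) ^ 2)) := by ring
        _ ≤ 2 * ((1 + M ^ 2) * (1 + M ^ 2)) * ((K ^ 2 + 4 * A ^ 2) * (x - y) ^ 2) := by gcongr
        _ ≤ 4 * ((1 + M ^ 2) * (1 + M ^ 2)) * ((K ^ 2 + 4 * A ^ 2) * (x - y) ^ 2) := by
            gcongr; norm_num
        _ = _ := by ring
    rw [norm_z_sub, sq_abs, mul_div_assoc', le_div_iff₀ (by positivity)]
    exact h6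
  have hC : 0 ≤ (1 + M ^ 2) ^ 2 * (K ^ 2 + 4 * A ^ 2) := by positivity
  refine ⟨√((1 + M ^ 2) ^ 2 * (K ^ 2 + 4 * A ^ 2)), fun x y => ?_⟩
  refine abs_le_of_sq_le_sq ?_ (by positivity)
  rw [mul_pow, Real.sq_sqrt hC]
  by_cases hx : |x| ≤ M
  · exact key x y hx
  by_cases hy : |y| ≤ M
  · have := key y x hy
    rwa [norm_sub_rev, show (ψ y - ψ x) ^ 2 = (ψ x - ψ y) ^ 2 by ring] at this
  · rw [hM x (not_le.mp hx), hM y (not_le.mp hy)]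
    simp only [sub_self, ne_eq, OfNat.ofNat_ne_zero, not_false_eq_true, zero_pow]
    positivity

lemma MemLHalf.integrable_mul_compactSupport {φ χ : ℝ → ℝ} (hφ : MemLHalf φ) (hχ : Continuous χ)
    (hc : HasCompactSupport χ) : Integrable fun x => φ x * χ x := by
  obtain ⟨C, hC⟩ := (hc.mul_right (f' := fun x : ℝ => 1 + x ^ 2)).exists_bound_of_continuous
    (by fun_prop)
  refine hφ.mul hχ.aestronglyMeasurable (C := C) fun x => ?_
  have := hC x
  rwa [Pi.mul_apply, Real.norm_eq_abs, abs_mul, abs_of_pos (by positivity : 0 < 1 + x ^ 2)] at this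

/-- This licenses Fubini in the definition of `|∇| φ` by duality, when `φ` is only integrable
against `1 / (1 + x²)`. -/
lemma integrable_mul_second_difference {φ ψ : ℝ → ℝ} (hφ : MemLHalf φ) (hm : StronglyMeasurable φ)
    (hψ : ContDiff ℝ (⊤ : ℕ∞) ψ) (hc : HasCompactSupport ψ) :
    Integrable fun p : ℝ × ℝ =>
      φ p.1 * ((2 * ψ p.1 - ψ (p.1 + p.2) - ψ (p.1 - p.2)) / p.2 ^ 2) := by
  obtain ⟨B, hB0, hB⟩ := second_difference_le hψ hc
  obtain ⟨M, hM0, hM⟩ := exists_support_bound hc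
  have hψc := hψ.continuous
  set Ψ : ℝ → ℝ := fun y => ψ y * (1 + y ^ 2) with hΨ
  have hΨc : Continuous Ψ := by fun_prop
  have hΨs : HasCompactSupport Ψ := hc.mul_right
  obtain ⟨A, hA⟩ := hΨs.exists_bound_of_continuous hΨc
  have hA0 : 0 ≤ A := (norm_nonneg _).trans (hA 0)
  set u : ℝ → ℝ := fun x => ‖φ x / (1 + x ^ 2)‖ with hu
  have hui : Integrable u := hφ.norm
  -- The first summand serves `|h| ≤ 1`, where the second difference lives in `|x| ≤ M + 1`; the
  -- second serves the central term `2 ψ x` for `|h| > 1`.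
  set D : ℝ := (1 + (M + 1) ^ 2) * B + 2 * A with hD
  have hΨi : Integrable fun y => ‖Ψ y‖ := (hΨc.integrable_of_hasCompactSupport hΨs).norm
  have hshear : Integrable fun p : ℝ × ℝ => u p.1 * ‖Ψ (p.1 + p.2)‖ :=
    (measurePreserving_prod_add (volume : Measure ℝ) volume).integrable_comp_of_integrable
      (hui.mul_prod hΨi)
  have hshear' : Integrable fun p : ℝ × ℝ => u p.1 * ‖Ψ (p.1 - p.2)‖ := by
    have hneg : MeasurePreserving (fun p : ℝ × ℝ => (p.1, -p.2)) (volume.prod volume)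
        (volume.prod volume) :=
      (MeasurePreserving.id volume).prod (Measure.measurePreserving_neg volume)
    have := hneg.integrable_comp_of_integrable hshear
    simp only [sub_eq_add_neg]
    exact this
  have hbound := ((hui.mul_prod (integrable_inv_one_add_sq.const_mul (2 * D))).add
    (hshear.const_mul 4)).add (hshear'.const_mul 4)
  refine hbound.mono' ?_ (Eventually.of_forall fun p => ?_)
  · refine Measurable.aestronglyMeasurable ?_
    have h1 : Continuous fun p : ℝ × ℝ => 2 * ψ p.1 - ψ (p.1 + p.2) - ψ (p.1 - p.2) := by
      fun_prop
    exact (hm.measurable.comp measurable_fst).mul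
      (h1.measurable.div (measurable_snd.pow_const 2))
  obtain ⟨x, h⟩ := p
  simp only [Pi.add_apply]
  have hx0 : 0 < 1 + x ^ 2 := by positivity
  have hsd : |(2 * ψ x - ψ (x + h) - ψ (x - h)) / h ^ 2| * (1 + x ^ 2) ≤
      2 * D * (1 + h ^ 2)⁻¹ + 4 * ‖Ψ (x + h)‖ + 4 * ‖Ψ (x - h)‖ := by
    have hD0 : 0 ≤ D := by positivity
    -- Small `h` uses the quadratic bound on the second difference. Large `h` treats the three terms
    -- separately, moving the weight onto `x ± h` by `one_add_sq_le`.
    rcases le_or_gt |h| 1 with hh | hh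
    · have h1 : |2 * ψ x - ψ (x + h) - ψ (x - h)| * (1 + x ^ 2) ≤ D * h ^ 2 := by
        by_cases hx : |x| ≤ M + 1
        · have h2 : |2 * ψ x - ψ (x + h) - ψ (x - h)| ≤ B * h ^ 2 := by
            rcases le_total 0 h with h0 | h0
            · exact hB x h h0
            · have := hB x (-h) (by linarith)
              rw [neg_sq, sub_neg_eq_add, ← sub_eq_add_neg] at this
              rwa [show 2 * ψ x - ψ (x + h) - ψ (x - h) = 2 * ψ x - ψ (x - h) - ψ (x + h) by ring]
          have h3 : 1 + x ^ 2 ≤ 1 + (M + 1) ^ 2 := by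
            rw [← sq_abs]; nlinarith [abs_nonneg x]
          calc _ ≤ B * h ^ 2 * (1 + (M + 1) ^ 2) := by gcongr
            _ = ((1 + (M + 1) ^ 2) * B) * h ^ 2 := by ring
            _ ≤ D * h ^ 2 := by gcongr; rw [hD]; linarith
        · rw [not_le] at hx
          have e1 : M < |x + h| := by
            have := abs_sub_abs_le_abs_sub x (-h)
            rw [abs_neg, sub_neg_eq_add] at this; linarith
          have e2 : M < |x - h| := by
            have := abs_sub_abs_le_abs_sub x h; linarith
          rw [hM x (by linarith), hM _ e1, hM _ e2]
          simp only [mul_zero, sub_self, abs_zero, zero_mul]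
          positivity
      have h2 : |(2 * ψ x - ψ (x + h) - ψ (x - h)) / h ^ 2| * (1 + x ^ 2) ≤ D := by
        rcases eq_or_ne h 0 with rfl | h0
        · simpa using hD0
        · have : 0 < h ^ 2 := by positivity
          rw [abs_div, abs_of_pos this, div_mul_eq_mul_div, div_le_iff₀ this]
          exact h1
      have h3 : D ≤ 2 * D * (1 + h ^ 2)⁻¹ := by
        rw [← div_eq_mul_inv, le_div_iff₀ (by positivity)]
        have : h ^ 2 ≤ 1 := by rw [← sq_abs]; nlinarith [abs_nonneg h]
        nlinarith
      have := norm_nonneg (Ψ (x + h))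
      have := norm_nonneg (Ψ (x - h))
      linarith
    · have hh2 : 1 ≤ h ^ 2 := by rw [← sq_abs]; nlinarith
      have hpos : 0 < h ^ 2 := by linarith
      have tail (t : ℝ) (ht : 1 + x ^ 2 ≤ 2 * ((1 + t ^ 2) * (1 + h ^ 2))) :
          |ψ t| * (1 + x ^ 2) / h ^ 2 ≤ 4 * ‖Ψ t‖ := by
        rw [div_le_iff₀ hpos, hΨ, Real.norm_eq_abs, abs_mul,
          abs_of_pos (by positivity : 0 < 1 + t ^ 2)]
        calc _ ≤ |ψ t| * (2 * ((1 + t ^ 2) * (1 + h ^ 2))) := by gcongr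
          _ ≤ |ψ t| * (2 * ((1 + t ^ 2) * (2 * h ^ 2))) := by gcongr; linarith
          _ = _ := by ring
      have t1 := tail (x + h) (one_add_sq_le x h)
      have t2 := tail (x - h) (by simpa [sub_eq_add_neg] using one_add_sq_le x (-h))
      have t3 : 2 * |ψ x| * (1 + x ^ 2) / h ^ 2 ≤ 2 * D * (1 + h ^ 2)⁻¹ := by
        have hAx := hA x
        rw [hΨ, Real.norm_eq_abs, abs_mul, abs_of_pos hx0] at hAx
        have hAD : 2 * A ≤ D := by
          rw [hD]
          linarith [mul_nonneg (by positivity : 0 ≤ 1 + (M + 1) ^ 2) hB0]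
        rw [← div_eq_mul_inv, div_le_div_iff₀ hpos (by positivity)]
        calc 2 * |ψ x| * (1 + x ^ 2) * (1 + h ^ 2) = 2 * (|ψ x| * (1 + x ^ 2)) * (1 + h ^ 2) := by ring
          _ ≤ 2 * A * (2 * h ^ 2) := by gcongr; linarith
          _ ≤ D * (2 * h ^ 2) := by gcongr
          _ = _ := by ring
      rw [abs_div, abs_of_pos hpos]
      have tri : |2 * ψ x - ψ (x + h) - ψ (x - h)| ≤ 2 * |ψ x| + |ψ (x + h)| + |ψ (x - h)| := by
        refine (abs_sub _ _).trans ?_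
        gcongr
        refine (abs_sub _ _).trans ?_
        rw [abs_mul, abs_two]
      calc _ ≤ (2 * |ψ x| + |ψ (x + h)| + |ψ (x - h)|) / h ^ 2 * (1 + x ^ 2) := by gcongr
        _ = 2 * |ψ x| * (1 + x ^ 2) / h ^ 2 + |ψ (x + h)| * (1 + x ^ 2) / h ^ 2 +
            |ψ (x - h)| * (1 + x ^ 2) / h ^ 2 := by ring
        _ ≤ _ := by gcongr
  have hφu : ‖φ x‖ = u x * (1 + x ^ 2) := by
    rw [hu]
    simp only [norm_div, Real.norm_eq_abs, abs_of_pos hx0]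
    field_simp
  rw [norm_mul, hφu, Real.norm_eq_abs (_ / _)]
  have hu0 : 0 ≤ u x := norm_nonneg _
  calc _ = u x * (|(2 * ψ x - ψ (x + h) - ψ (x - h)) / h ^ 2| * (1 + x ^ 2)) := by ring
    _ ≤ u x * (2 * D * (1 + h ^ 2)⁻¹ + 4 * ‖Ψ (x + h)‖ + 4 * ‖Ψ (x - h)‖) := by gcongr
    _ = _ := by ring

/-- The distribution `|∇| φ` is given by the bilinear form. -/
lemma integral_mul_absNabla {φ ψ : ℝ → ℝ} (hφ : MemLHalf φ) (hm : StronglyMeasurable φ)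
    (hE : MemLp (diffQuot φ) 2) (hψ : ContDiff ℝ (⊤ : ℕ∞) ψ) (hc : HasCompactSupport ψ) :
    ∫ x, φ x * absNabla ψ x = energy φ ψ := by
  obtain ⟨C, hC⟩ := exists_chordal_bound hψ hc
  have hψc := hψ.continuous
  have hEψ : MemLp (diffQuot ψ) 2 := memLp_diffQuot_of_chordal hψc.measurable hC
  have hF := integrable_diffQuot_mul hE hEψ
  have hG := integrable_mul_second_difference hφ hm hψ hc
  have h1 (x : ℝ) : φ x * absNabla ψ x = (2 * Real.pi)⁻¹ *
      ∫ h, φ x * ((2 * ψ x - ψ (x + h) - ψ (x - h)) / h ^ 2) := by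
    -- The integrand is even in `h`, so the half-line integral is half the integral over the line;
    -- this turns `1/π` into `1/(2π)`.
    have e := integral_comp_abs (f := fun h => (2 * ψ x - ψ (x + h) - ψ (x - h)) / h ^ 2)
    have e' : ∀ h : ℝ, (2 * ψ x - ψ (x + |h|) - ψ (x - |h|)) / |h| ^ 2 =
        (2 * ψ x - ψ (x + h) - ψ (x - h)) / h ^ 2 := by
      intro h
      rw [sq_abs]
      congr 1
      rcases abs_choice h with hh | hh <;> rw [hh]
      rw [sub_neg_eq_add, ← sub_eq_add_neg]
      ring
    simp only [e'] at e
    rw [integral_const_mul, e, absNabla]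
    field_simp
  simp only [h1]
  rw [integral_const_mul, energy]
  congr 1
  rw [integral_integral_swap (f := fun x h => φ x * ((2 * ψ x - ψ (x + h) - ψ (x - h)) / h ^ 2)) hG]
  -- Substituting `y = x + h` in the energy reduces the claim to an identity of `x`-integrals for
  -- each fixed `h`. There, translation invariance matches the terms shifted in `φ` with those
  -- shifted in `ψ`.
  have hmp := measurePreserving_prod_add (volume : Measure ℝ) volume
  have hemb : MeasurableEmbedding fun p : ℝ × ℝ => (p.1, p.1 + p.2) :=
    (MeasurableEquiv.shearAddRight ℝ).measurableEmbedding
  have hF' : Integrable (fun p : ℝ × ℝ => diffQuot φ (p.1, p.1 + p.2) * diffQuot ψ (p.1, p.1 + p.2))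
      (volume.prod volume) := hmp.integrable_comp_of_integrable hF
  have h2 := hmp.integral_comp hemb (fun p => diffQuot φ p * diffQuot ψ p)
  rw [Measure.volume_eq_prod, ← h2, integral_prod_symm _ hF']
  refine integral_congr_ae (Eventually.of_forall fun h => ?_)
  simp only [diffQuot]
  have shift (c : ℝ) : HasCompactSupport fun x => ψ (x + c) :=
    hc.comp_homeomorph (Homeomorph.addRight c)
  have i0 := hφ.integrable_mul_compactSupport hψc hc
  have i1 := hφ.integrable_mul_compactSupport (χ := fun x => ψ (x + h)) (by fun_prop) (shift h)
  have i2 := hφ.integrable_mul_compactSupport (χ := fun x => ψ (x + -h)) (by fun_prop) (shift (-h))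
  have i3 : Integrable fun x => φ (x + h) * ψ (x + h) := i0.comp_add_right h
  have i4 : Integrable fun x => φ (x + h) * ψ x := by
    refine (i2.comp_add_right h).congr (Eventually.of_forall fun x => ?_)
    simp
  have s3 : ∫ x, φ (x + h) * ψ (x + h) = ∫ x, φ x * ψ x :=
    integral_add_right_eq_self (fun x => φ x * ψ x) h
  have s4 : ∫ x, φ (x + h) * ψ x = ∫ x, φ x * ψ (x + -h) := by
    have := integral_add_right_eq_self (μ := volume) (fun x => φ x * ψ (x + -h)) h
    simpa using this
  have l : ∫ x, φ x * ((2 * ψ x - ψ (x + h) - ψ (x - h)) / h ^ 2) =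
      (h ^ 2)⁻¹ * ∫ x, (2 * (φ x * ψ x) - φ x * ψ (x + h) - φ x * ψ (x + -h)) := by
    rw [← integral_const_mul]
    congr 1; funext x
    rw [sub_eq_add_neg x h]
    ring
  have r : ∫ x, (φ x - φ (x + h)) / (x - (x + h)) * ((ψ x - ψ (x + h)) / (x - (x + h))) =
      (h ^ 2)⁻¹ * ∫ x, (φ x * ψ x - φ x * ψ (x + h) - φ (x + h) * ψ x +
        φ (x + h) * ψ (x + h)) := by
    rw [← integral_const_mul]
    congr 1; funext x
    rw [show x - (x + h) = -h by ring, div_neg, div_neg]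
    ring
  have a := integral_sub ((i0.const_mul 2).sub i1) i2
  have a' := integral_sub (i0.const_mul 2) i1
  have b := integral_add ((i0.sub i1).sub i4) i3
  have b' := integral_sub (i0.sub i1) i4
  have b'' := integral_sub i0 i1
  simp only [Pi.sub_apply] at a b b'
  rw [l, r, a, a', b, b', b'', integral_const_mul, s3, s4]
  ring

/-! ### Poisson regularization and the eigenvalue of `|∇|`. -/

lemma norm_z_sub_smul_sq (x y r : ℝ) :
    ((‖z x - r * z y‖ ^ 2 : ℝ) : ℂ) = (1 - r * (z y * (z x)⁻¹)) * (1 - r * (z x * (z y)⁻¹)) := by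
  have hx := z_ne_zero x
  have hy := z_ne_zero y
  push_cast
  rw [← Complex.conj_mul', map_sub, map_mul, conj_z, conj_z, Complex.conj_ofReal]
  field_simp

lemma one_sub_le_norm_z_sub_smul (x y : ℝ) {r : ℝ} (hr : 0 ≤ r) :
    1 - r ≤ ‖z x - r * z y‖ := by
  have := norm_sub_norm_le (z x) (r * z y)
  rwa [norm_mul, norm_z, norm_z, Complex.norm_real, Real.norm_of_nonneg hr, mul_one] at this

lemma norm_z_sub_smul_pos (x y : ℝ) {r : ℝ} (hr : 0 ≤ r) (hr1 : r < 1) :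
    0 < ‖z x - r * z y‖ :=
  lt_of_lt_of_le (by linarith) (one_sub_le_norm_z_sub_smul x y hr)

lemma norm_z_sub_smul_comm (x y r : ℝ) : ‖z x - r * z y‖ = ‖z y - r * z x‖ := by
  rw [← sq_eq_sq₀ (norm_nonneg _) (norm_nonneg _)]
  have h : ((‖z x - r * z y‖ ^ 2 : ℝ) : ℂ) = ((‖z y - r * z x‖ ^ 2 : ℝ) : ℂ) := by
    rw [norm_z_sub_smul_sq, norm_z_sub_smul_sq, mul_comm]
  exact_mod_cast h

lemma continuous_norm_z_sub_smul (r : ℝ) :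
    Continuous fun p : ℝ × ℝ => ‖z p.1 - r * z p.2‖ := by
  have := continuous_z
  fun_prop

/-- The sum of two conjugate geometric series. Both start at `n = 0`, so the constant term is
counted twice; this is the extra `1` beside the Poisson kernel. -/
lemma hasSum_poisson (x y : ℝ) {r : ℝ} (hr : 0 ≤ r) (hr1 : r < 1) :
    HasSum (fun n : ℕ => (r : ℂ) ^ n * (z x ^ (-(n : ℤ)) * z y ^ n + z x ^ n * z y ^ (-(n : ℤ))))
      (1 + (1 - r ^ 2) / ((‖z x - r * z y‖ ^ 2 : ℝ) : ℂ)) := by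
  have hx := z_ne_zero x
  have hy := z_ne_zero y
  have hn (s t : ℝ) : ‖(r : ℂ) * (z s * (z t)⁻¹)‖ < 1 := by
    rw [norm_mul, norm_mul, norm_inv, norm_z, norm_z, Complex.norm_real, Real.norm_of_nonneg hr]
    linarith
  have hne (s t : ℝ) : 1 - (r : ℂ) * (z s * (z t)⁻¹) ≠ 0 := by
    intro h
    have := hn s t
    rw [← sub_eq_zero.mp h] at this
    simp at this
  have h := (hasSum_geometric_of_norm_lt_one (hn y x)).add
    (hasSum_geometric_of_norm_lt_one (hn x y))
  have e1 (n : ℕ) : (r : ℂ) ^ n * (z x ^ (-(n : ℤ)) * z y ^ n + z x ^ n * z y ^ (-(n : ℤ))) =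
      (r * (z y * (z x)⁻¹)) ^ n + (r * (z x * (z y)⁻¹)) ^ n := by
    rw [mul_pow, mul_pow, mul_pow, mul_pow, zpow_neg, zpow_neg, zpow_natCast, zpow_natCast,
      inv_pow, inv_pow]
    ring
  have e2 : 1 + (1 - (r : ℂ) ^ 2) / ((‖z x - r * z y‖ ^ 2 : ℝ) : ℂ) =
      (1 - r * (z y * (z x)⁻¹))⁻¹ + (1 - r * (z x * (z y)⁻¹))⁻¹ := by
    rw [norm_z_sub_smul_sq]
    have h1 := hne y x
    have h2 := hne x y
    have e : (z y * (z x)⁻¹) * (z x * (z y)⁻¹) = 1 := by field_simp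
    generalize z y * (z x)⁻¹ = A at *
    generalize z x * (z y)⁻¹ = B at *
    field_simp
    linear_combination (r : ℂ) ^ 2 * e
  simp only [e1, e2]
  exact h

/-- The Poisson integral of `z ^ k` is its harmonic extension `r ^ k z ^ k`, by integrating the
series term by term. -/
lemma integral_poisson (k : ℕ) (x : ℝ) {r : ℝ} (hr : 0 ≤ r) (hr1 : r < 1) :
    ∫ y, (w y : ℂ) * z y ^ k * ((1 - r ^ 2) / ((‖z x - r * z y‖ ^ 2 : ℝ) : ℂ)) =
      2 * Real.pi * (r ^ k * z x ^ k) := by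
  set F : ℕ → ℝ → ℂ := fun n y => (w y : ℂ) * z y ^ k *
    ((r : ℂ) ^ n * (z x ^ (-(n : ℤ)) * z y ^ n + z x ^ n * z y ^ (-(n : ℤ)))) with hF
  have hFe (n : ℕ) (y : ℝ) : F n y =
      (r : ℂ) ^ n * z x ^ (-(n : ℤ)) * (w y * z y ^ ((k : ℤ) + n)) +
      (r : ℂ) ^ n * z x ^ n * (w y * z y ^ ((k : ℤ) - n)) := by
    have := z_ne_zero y
    simp only [hF]
    rw [zpow_add₀ this, zpow_sub₀ this, zpow_natCast, zpow_natCast, zpow_neg, zpow_neg,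
      zpow_natCast, zpow_natCast]
    field_simp
  have hFi (n : ℕ) : Integrable (F n) := by
    simp only [funext (hFe n)]
    exact ((integrable_w_mul_zpow _).const_mul _).add ((integrable_w_mul_zpow _).const_mul _)
  have hFn (n : ℕ) (y : ℝ) : ‖F n y‖ ≤ 2 * r ^ n * w y := by
    rw [hFe]
    refine (norm_add_le _ _).trans (le_of_eq ?_)
    simp only [norm_mul, norm_pow, norm_z_zpow, norm_z, Complex.norm_real, Real.norm_of_nonneg hr,
      Real.norm_of_nonneg (w_pos y).le]
    ring
  have hsum : Summable fun n => ∫ y, ‖F n y‖ := by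
    refine Summable.of_nonneg_of_le (fun n => integral_nonneg fun y => norm_nonneg _)
      (fun n => integral_mono (hFi n).norm (integrable_w.const_mul (2 * r ^ n)) (hFn n)) ?_
    simp only [integral_const_mul]
    exact ((summable_geometric_of_lt_one hr hr1).mul_left 2).mul_right _
  have h := hasSum_integral_of_summable_integral_norm hFi hsum
  -- The first summand, present only for `n = k = 0`, comes from the doubly counted constant term
  -- and cancels against it at the end.
  have hFint (n : ℕ) : ∫ y, F n y = (if n = 0 then (if k = 0 then 2 * (Real.pi : ℂ) else 0) else 0)
      + if n = k then 2 * Real.pi * (r ^ k * z x ^ k) else 0 := by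
    simp only [hFe]
    rw [integral_add ((integrable_w_mul_zpow _).const_mul _) ((integrable_w_mul_zpow _).const_mul _),
      integral_const_mul, integral_const_mul, integral_w_mul_zpow, integral_w_mul_zpow]
    congr 1
    · by_cases hn : n = 0
      · subst hn
        simp
      · rw [if_neg hn, if_neg (by omega), mul_zero]
    · by_cases hn : n = k
      · subst hn
        simp only [sub_self, if_true]
        ring
      · rw [if_neg hn, if_neg (by omega), mul_zero]
  have h' : HasSum (fun n => ∫ y, F n y)
      ((if k = 0 then 2 * (Real.pi : ℂ) else 0) + 2 * Real.pi * (r ^ k * z x ^ k)) := by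
    simp only [hFint]
    exact (hasSum_ite_eq 0 _).add (hasSum_ite_eq k _)
  have htsum (y : ℝ) : ∑' n, F n y = (w y : ℂ) * z y ^ k +
      (w y : ℂ) * z y ^ k * ((1 - r ^ 2) / ((‖z x - r * z y‖ ^ 2 : ℝ) : ℂ)) := by
    rw [((hasSum_poisson x y hr hr1).mul_left _).tsum_eq]
    ring
  have hi0 : Integrable fun y => (w y : ℂ) * z y ^ k := by
    simpa using integrable_w_mul_zpow k
  have hi1 : Integrable fun y =>
      (w y : ℂ) * z y ^ k * ((1 - r ^ 2) / ((‖z x - r * z y‖ ^ 2 : ℝ) : ℂ)) := by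
    refine hi0.mul_bdd (c := (1 - r ^ 2) / (1 - r) ^ 2) ?_ (Eventually.of_forall fun y => ?_)
    · refine Continuous.aestronglyMeasurable (continuous_const.div ?_ fun y => ?_)
      · exact Complex.continuous_ofReal.comp
          (((continuous_norm_z_sub_smul r).comp (Continuous.prodMk_right x)).pow 2)
      · have := norm_z_sub_smul_pos x y hr hr1
        exact_mod_cast (pow_pos this 2).ne'
    · have e : (1 - (r : ℂ) ^ 2) / ((‖z x - r * z y‖ ^ 2 : ℝ) : ℂ) =
          (((1 - r ^ 2) / ‖z x - r * z y‖ ^ 2 : ℝ) : ℂ) := by push_cast; rfl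
      have h1 := one_sub_le_norm_z_sub_smul x y hr
      have h2 : 0 < 1 - r := by linarith
      have h3 : 0 ≤ 1 - r ^ 2 := by nlinarith
      rw [e, Complex.norm_real, Real.norm_of_nonneg (by positivity)]
      gcongr
  have h0 : ∫ y, (w y : ℂ) * z y ^ k = if k = 0 then 2 * (Real.pi : ℂ) else 0 := by
    have := integral_w_mul_zpow k
    simpa using this
  have heq := h'.unique h
  simp only [htsum] at heq
  rw [integral_add hi0 hi1, h0] at heq
  exact (add_left_cancel heq).symm

/-- The difference of the Poisson integrals of degrees `0` and `k` gives `(1 - r ^ k) / (1 - r ^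
2)`. Cancelling `1 - r` leaves a form continuous at `r = 1`, with value `k / 2`. -/
lemma integral_w_mul_mode_sub (ℓ : ℂ →L[ℝ] ℝ) (k : ℕ) (x : ℝ) {r : ℝ} (hr : 0 ≤ r) (hr1 : r < 1) :
    ∫ y, w y * (mode ℓ k x - mode ℓ k y) / ‖z x - r * z y‖ ^ 2 =
      2 * Real.pi * ((∑ j ∈ Finset.range k, r ^ j) / (1 + r)) * mode ℓ k x := by
  have h2 : 0 < 1 - r := by linarith
  have hc : Continuous fun y => (‖z x - r * z y‖ ^ 2)⁻¹ :=
    (((continuous_norm_z_sub_smul r).comp (Continuous.prodMk_right x)).pow 2).inv₀ fun y =>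
      (pow_pos (norm_z_sub_smul_pos x y hr hr1) 2).ne'
  have hi (j : ℕ) : Integrable fun y => (w y : ℂ) * z y ^ j * ((‖z x - r * z y‖ ^ 2)⁻¹ : ℝ) := by
    have hi0 : Integrable fun y => (w y : ℂ) * z y ^ j := by
      simpa using integrable_w_mul_zpow j
    refine hi0.mul_bdd (c := ((1 - r) ^ 2)⁻¹)
      (Complex.continuous_ofReal.comp hc).aestronglyMeasurable (Eventually.of_forall fun y => ?_)
    have h1 := one_sub_le_norm_z_sub_smul x y hr
    rw [Complex.norm_real, Real.norm_of_nonneg (by positivity)]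
    gcongr
  have hp (j : ℕ) : (1 - (r : ℂ) ^ 2) * ∫ y, (w y : ℂ) * z y ^ j * ((‖z x - r * z y‖ ^ 2)⁻¹ : ℝ) =
      2 * Real.pi * (r ^ j * z x ^ j) := by
    rw [← integral_poisson j x hr hr1, ← integral_const_mul]
    congr 1; funext y
    push_cast
    rw [div_eq_mul_inv]
    ring
  have hr2 : (1 - (r : ℂ) ^ 2) ≠ 0 := by
    have : (1 - r ^ 2) ≠ 0 := by nlinarith
    exact_mod_cast this
  have hr3 : (1 + (r : ℂ)) ≠ 0 := by
    have : (1 + r) ≠ 0 := by linarith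
    exact_mod_cast this
  have hd : ∫ y, ((w y / ‖z x - r * z y‖ ^ 2 : ℝ) : ℂ) * (z x ^ k - z y ^ k) =
      ((2 * Real.pi * ((∑ j ∈ Finset.range k, r ^ j) / (1 + r)) : ℝ) : ℂ) * z x ^ k := by
    have e (y : ℝ) : ((w y / ‖z x - r * z y‖ ^ 2 : ℝ) : ℂ) * (z x ^ k - z y ^ k) =
        z x ^ k * ((w y : ℂ) * z y ^ 0 * ((‖z x - r * z y‖ ^ 2)⁻¹ : ℝ)) -
          (w y : ℂ) * z y ^ k * ((‖z x - r * z y‖ ^ 2)⁻¹ : ℝ) := by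
      push_cast
      rw [div_eq_mul_inv]
      ring
    simp only [e]
    rw [integral_sub ((hi 0).const_mul _) (hi k), integral_const_mul]
    apply mul_left_cancel₀ hr2
    rw [mul_sub, mul_left_comm, hp 0, hp k]
    have hg : (∑ j ∈ Finset.range k, (r : ℂ) ^ j) * (1 - r) = 1 - r ^ k := geom_sum_mul_neg _ k
    push_cast
    field_simp
    linear_combination -(1 + (r : ℂ)) * z x ^ k * hg
  have hint : Integrable fun y => ((w y / ‖z x - r * z y‖ ^ 2 : ℝ) : ℂ) * (z x ^ k - z y ^ k) := by
    refine (((hi 0).const_mul (z x ^ k)).sub (hi k)).congr (Eventually.of_forall fun y => ?_)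
    simp only [Pi.sub_apply]
    push_cast
    rw [div_eq_mul_inv]
    ring
  have smul_eq (c : ℝ) (u : ℂ) : ℓ (c * u) = c * ℓ u := by
    rw [← Complex.real_smul, map_smul, smul_eq_mul]
  have hl := ℓ.integral_comp_comm hint
  simp only [hd, smul_eq] at hl
  unfold mode
  rw [← hl]
  congr 1; funext y
  rw [map_sub]
  ring

lemma MemLHalf.integrable_w_mul {φ : ℝ → ℝ} (hφ : MemLHalf φ) : Integrable fun x => w x * φ x := by
  refine (Integrable.const_mul hφ 2).congr (Eventually.of_forall fun x => ?_)
  simp only [w]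
  ring

lemma MemLHalf.integrable_w_mul_mul {φ u : ℝ → ℝ} (hφ : MemLHalf φ) (hu : Continuous u) {C : ℝ}
    (hC : ∀ x, |u x| ≤ C) : Integrable fun x => w x * φ x * u x :=
  hφ.integrable_w_mul.mul_bdd (c := C) hu.aestronglyMeasurable (Eventually.of_forall hC)

/-- For `r < 1` the kernel is bounded, so the product of differences may be split into two
absolutely convergent pieces. They are exchanged by swapping the variables, as
`norm_z_sub_smul_comm` permits, and the integral over the other variable is then explicit. -/
lemma integral_regularized (ℓ : ℂ →L[ℝ] ℝ) (k : ℕ) {φ : ℝ → ℝ} (hφ : MemLHalf φ)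
    {r : ℝ} (hr : 0 ≤ r) (hr1 : r < 1) :
    ∫ p : ℝ × ℝ, w p.1 * w p.2 * ((φ p.1 - φ p.2) * (mode ℓ k p.1 - mode ℓ k p.2)) /
        ‖z p.1 - r * z p.2‖ ^ 2 =
      4 * Real.pi * ((∑ j ∈ Finset.range k, r ^ j) / (1 + r)) * ∫ x, w x * φ x * mode ℓ k x := by
  have h2 : 0 < 1 - r := by linarith
  set G : ℝ × ℝ → ℝ := fun p => w p.1 * φ p.1 *
    (w p.2 * (mode ℓ k p.1 - mode ℓ k p.2) / ‖z p.1 - r * z p.2‖ ^ 2) with hG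
  have hmode := continuous_mode ℓ k
  have hGi : Integrable G (volume.prod volume) := by
    have hb : Continuous fun p : ℝ × ℝ =>
        (mode ℓ k p.1 - mode ℓ k p.2) / ‖z p.1 - r * z p.2‖ ^ 2 :=
      Continuous.div (by fun_prop) ((continuous_norm_z_sub_smul r).pow 2) fun p =>
        (pow_pos (norm_z_sub_smul_pos p.1 p.2 hr hr1) 2).ne'
    have := (hφ.integrable_w_mul.mul_prod integrable_w).mul_bdd
      (c := (‖ℓ‖ + ‖ℓ‖) / (1 - r) ^ 2) hb.aestronglyMeasurable (Eventually.of_forall fun p => by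
        have h1 := one_sub_le_norm_z_sub_smul p.1 p.2 hr
        rw [Real.norm_eq_abs, abs_div, abs_of_nonneg (by positivity : 0 ≤ ‖z p.1 - r * z p.2‖ ^ 2)]
        gcongr
        exact (abs_sub _ _).trans (add_le_add (abs_mode_le ℓ k _) (abs_mode_le ℓ k _)))
    refine this.congr (Eventually.of_forall fun p => ?_)
    simp only [hG]
    ring
  have hval : ∫ p, G p = 2 * Real.pi * ((∑ j ∈ Finset.range k, r ^ j) / (1 + r)) *
      ∫ x, w x * φ x * mode ℓ k x := by
    rw [Measure.volume_eq_prod, integral_prod _ hGi, ← integral_const_mul]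
    congr 1; funext x
    simp only [hG]
    rw [integral_const_mul, integral_w_mul_mode_sub ℓ k x hr hr1]
    ring
  have hsum : ∫ p : ℝ × ℝ, w p.1 * w p.2 * ((φ p.1 - φ p.2) * (mode ℓ k p.1 - mode ℓ k p.2)) /
        ‖z p.1 - r * z p.2‖ ^ 2 = ∫ p : ℝ × ℝ, (G p + G p.swap) := by
    congr 1; funext p
    simp only [hG, Prod.fst_swap, Prod.snd_swap]
    rw [norm_z_sub_smul_comm p.2 p.1]
    ring
  have hswap : ∫ p : ℝ × ℝ, G p.swap = ∫ p, G p := by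
    rw [Measure.volume_eq_prod]
    exact integral_prod_swap G
  have hadd := integral_add hGi hGi.swap
  rw [hsum]
  refine hadd.trans ?_
  change (∫ p, G p) + ∫ p : ℝ × ℝ, G p.swap = _
  rw [hswap, hval]
  ring

/-- This gives a majorant of the regularized kernels uniform in `r`, namely four times the singular
one. -/
lemma norm_z_sub_le_two_mul (x y : ℝ) {r : ℝ} (hr : 0 ≤ r) (hr1 : r < 1) :
    ‖z x - z y‖ ≤ 2 * ‖z x - r * z y‖ := by
  have h1 := one_sub_le_norm_z_sub_smul x y hr
  have h2 := norm_sub_le (z x - r * z y) ((1 - r : ℝ) * z y)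
  rw [norm_mul, norm_z, Complex.norm_real, Real.norm_of_nonneg (by linarith)] at h2
  have e : z x - r * z y - (1 - r : ℝ) * z y = z x - z y := by push_cast; ring
  rw [e] at h2
  linarith

/-- `|∇|` acts on `ℓ (z ^ k)` as multiplication by `k w`. -/
lemma energy_mode (ℓ : ℂ →L[ℝ] ℝ) (k : ℕ) {φ : ℝ → ℝ} (hφ : MemLHalf φ)
    (hm : StronglyMeasurable φ) (hE : MemLp (diffQuot φ) 2) :
    energy φ (mode ℓ k) = k * ∫ x, w x * φ x * mode ℓ k x := by
  have hmode := continuous_mode ℓ k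
  have hEm : MemLp (diffQuot (mode ℓ k)) 2 :=
    memLp_diffQuot_of_chordal hmode.measurable (abs_mode_sub_le ℓ k)
  have hI := integrable_diffQuot_mul hE hEm
  set F : ℝ → ℝ × ℝ → ℝ := fun r p => w p.1 * w p.2 *
    ((φ p.1 - φ p.2) * (mode ℓ k p.1 - mode ℓ k p.2)) / ‖z p.1 - r * z p.2‖ ^ 2 with hF
  have hev : ∀ᶠ r : ℝ in 𝓝[<] 1, 0 ≤ r ∧ r < 1 := by
    have : Set.Ico (0 : ℝ) 1 ∈ 𝓝[<] (1 : ℝ) := Ico_mem_nhdsLT (by norm_num)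
    exact this
  -- Conformality identifies the energy integrand with the unregularized case `r = 1`; on the
  -- diagonal both sides are `0`.
  have hone (p : ℝ × ℝ) : diffQuot φ p * diffQuot (mode ℓ k) p = F 1 p := by
    rcases eq_or_ne p.1 p.2 with e | e
    · simp [diffQuot, hF, e]
    · have hd : p.1 - p.2 ≠ 0 := sub_ne_zero.mpr e
      have := (w_pos p.1).ne'
      have := (w_pos p.2).ne'
      simp only [hF, diffQuot, Complex.ofReal_one, one_mul]
      rw [norm_z_sub_sq]
      field_simp
  have hlim : Tendsto (fun r => ∫ p, F r p) (𝓝[<] 1) (𝓝 (∫ p, F 1 p)) := by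
    refine tendsto_integral_filter_of_dominated_convergence
      (fun p => 4 * ‖diffQuot φ p * diffQuot (mode ℓ k) p‖) ?_ ?_ (hI.norm.const_mul 4) ?_
    · refine Eventually.of_forall fun r => Measurable.aestronglyMeasurable ?_
      have h1 := hm.measurable
      have h2 := hmode.measurable
      have h3 := continuous_w.measurable
      have h4 := (continuous_norm_z_sub_smul r).measurable
      simp only [hF]
      exact (((h3.comp measurable_fst).mul (h3.comp measurable_snd)).mul
        (((h1.comp measurable_fst).sub (h1.comp measurable_snd)).mul
          ((h2.comp measurable_fst).sub (h2.comp measurable_snd)))).div (h4.pow_const 2)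
    · filter_upwards [hev] with r hr
      refine Eventually.of_forall fun p => ?_
      rw [hone]
      rcases eq_or_ne p.1 p.2 with e | e
      · simp [hF, e]
      · have hd : 0 < ‖z p.1 - z p.2‖ :=
          norm_pos_iff.mpr (sub_ne_zero.mpr fun h => e (z_injective h))
        have hp := norm_z_sub_smul_pos p.1 p.2 hr.1 hr.2
        have h2 := norm_z_sub_le_two_mul p.1 p.2 hr.1 hr.2
        simp only [hF, Complex.ofReal_one, one_mul, norm_div, norm_pow, norm_norm]
        rw [mul_div_assoc', div_le_div_iff₀ (by positivity) (by positivity)]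
        have hN := norm_nonneg (w p.1 * w p.2 * ((φ p.1 - φ p.2) * (mode ℓ k p.1 - mode ℓ k p.2)))
        have h3 : ‖z p.1 - z p.2‖ ^ 2 ≤ 4 * ‖z p.1 - r * z p.2‖ ^ 2 := by
          calc _ ≤ (2 * ‖z p.1 - r * z p.2‖) ^ 2 := by gcongr
            _ = _ := by ring
        refine (mul_le_mul_of_nonneg_left h3 hN).trans_eq (by ring)
    · refine Eventually.of_forall fun p => ?_
      rcases eq_or_ne p.1 p.2 with e | e
      · simp [hF, e]
      · have hd : ‖z p.1 - z p.2‖ ≠ 0 :=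
          norm_ne_zero_iff.mpr (sub_ne_zero.mpr fun h => e (z_injective h))
        refine Tendsto.mono_left ?_ nhdsWithin_le_nhds
        have hc : ContinuousAt (fun r : ℝ => ‖z p.1 - r * z p.2‖ ^ 2) 1 := by fun_prop
        exact (tendsto_const_nhds.div hc (by simpa using hd))
  have hlim2 : Tendsto (fun r : ℝ => ∫ p, F r p) (𝓝[<] 1)
      (𝓝 (4 * Real.pi * ((∑ j ∈ Finset.range k, (1 : ℝ) ^ j) / (1 + 1)) *
        ∫ x, w x * φ x * mode ℓ k x)) := by
    have hc : ContinuousAt (fun r : ℝ => 4 * Real.pi * ((∑ j ∈ Finset.range k, r ^ j) / (1 + r)) *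
        ∫ x, w x * φ x * mode ℓ k x) 1 := by
      have h1 : ContinuousAt (fun r : ℝ => ∑ j ∈ Finset.range k, r ^ j) 1 := by fun_prop
      have h2 : ContinuousAt (fun r : ℝ => 1 + r) 1 := by fun_prop
      exact (continuousAt_const.mul (h1.div h2 (by norm_num))).mul continuousAt_const
    refine (hc.tendsto.mono_left nhdsWithin_le_nhds).congr' ?_
    filter_upwards [hev] with r hr
    exact (integral_regularized ℓ k hφ hr.1 hr.2).symm
  have heq := tendsto_nhds_unique hlim hlim2
  unfold energy
  simp only [hone]
  rw [heq]
  have := Real.pi_pos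
  simp only [one_pow, Finset.sum_const, Finset.card_range, nsmul_eq_mul, mul_one]
  field_simp
  ring

/-! ### Approximating modes by test functions. -/

lemma contDiff_mode (ℓ : ℂ →L[ℝ] ℝ) (k : ℕ) : ContDiff ℝ (⊤ : ℕ∞) (mode ℓ k) := by
  have hx : ContDiff ℝ (⊤ : ℕ∞) (fun x : ℝ => (x : ℂ)) := Complex.ofRealCLM.contDiff
  have hz : ContDiff ℝ (⊤ : ℕ∞) z := by
    unfold z
    simp only [div_eq_mul_inv]
    exact contDiff_const.mul ((hx.sub contDiff_const).mul
      ((hx.add contDiff_const).inv ofReal_add_I_ne_zero))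
  exact ℓ.contDiff.comp (hz.pow k)

/-- A smooth function vanishing near `0`, whose rescalings `N⁻¹ τ(N s)` tend to `s`. -/
lemma exists_smooth_threshold : ∃ (τ : ℝ → ℝ) (K A : ℝ), ContDiff ℝ (⊤ : ℕ∞) τ ∧
    (∀ s, |s| ≤ 1 → τ s = 0) ∧ (∀ s t, |τ s - τ t| ≤ K * |s - t|) ∧ ∀ s, |τ s - s| ≤ A := by
  let b : ContDiffBump (0 : ℝ) := ⟨1, 2, by norm_num, by norm_num⟩
  have hb : ContDiff ℝ (⊤ : ℕ∞) b := b.contDiff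
  have hs : HasCompactSupport fun s : ℝ => s * b s := b.hasCompactSupport.mul_left
  have hsc : ContDiff ℝ (⊤ : ℕ∞) fun s : ℝ => s * b s := contDiff_id.mul hb
  obtain ⟨K, hK⟩ := hsc.lipschitzWith_of_hasCompactSupport hs (by simp)
  obtain ⟨A, hA⟩ := hs.exists_bound_of_continuous hsc.continuous
  -- The bump `b` equals `1` on the unit ball and has compact support, so this function vanishes
  -- there and stays within bounded distance of the identity.
  refine ⟨fun s => s - s * b s, 1 + K, A, contDiff_id.sub hsc, fun s h1 => ?_, fun s t => ?_,
    fun s => ?_⟩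
  · have : b s = 1 := b.one_of_mem_closedBall (by simpa [b] using h1)
    simp [this]
  · have := hK.dist_le_mul s t
    rw [Real.dist_eq, Real.dist_eq] at this
    rw [show s - s * b s - (t - t * b t) = (s - t) - (s * b s - t * b t) by ring]
    refine (abs_sub _ _).trans ?_
    rw [add_mul, one_mul]
    gcongr
  · have := hA s
    rw [Real.norm_eq_abs] at this
    rwa [show s - s * b s - s = -(s * b s) by ring, abs_neg]

/-- Test functions approximating `ℓ (z ^ k)` minus its value at infinity. -/
lemma exists_test_sequence (ℓ : ℂ →L[ℝ] ℝ) (k : ℕ) : ∃ (ψ : ℕ → ℝ → ℝ) (C : ℝ),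
    (∀ n, ContDiff ℝ (⊤ : ℕ∞) (ψ n)) ∧ (∀ n, HasCompactSupport (ψ n)) ∧
    (∀ n x y, |ψ n x - ψ n y| ≤ C * ‖z x - z y‖) ∧ (∀ n x, |ψ n x| ≤ C) ∧
    ∀ x, Tendsto (fun n => ψ n x) atTop (𝓝 (mode ℓ k x - ℓ (Complex.I ^ k))) := by
  obtain ⟨τ, K, A, hτ, hτ0, hτK, hτA⟩ := exists_smooth_threshold
  set a := ℓ (Complex.I ^ k) with ha
  have hK0 : 0 ≤ K := by
    have := (abs_nonneg _).trans (hτK 1 0)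
    simpa using this
  have hlip (n : ℕ) (s t : ℝ) : |((n : ℝ) + 1)⁻¹ * τ ((n + 1) * s) - ((n : ℝ) + 1)⁻¹ *
      τ ((n + 1) * t)| ≤ K * |s - t| := by
    have hN : (0 : ℝ) < n + 1 := by positivity
    rw [← mul_sub, abs_mul, abs_of_pos (inv_pos.mpr hN), inv_mul_le_iff₀ hN]
    refine (hτK _ _).trans_eq ?_
    rw [← mul_sub, abs_mul, abs_of_pos hN]
    ring
  have ha_le : |a| ≤ ‖ℓ‖ := by
    have := ℓ.le_opNorm (Complex.I ^ k)
    rwa [norm_pow, Complex.norm_I, one_pow, mul_one] at this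
  -- The rescaled threshold kills all values within `1/(n+1)` of `a`, while its Lipschitz constant
  -- does not depend on `n`. Since the mode tends to `a` at infinity, the support is compact.
  refine ⟨fun n x => ((n : ℝ) + 1)⁻¹ * τ ((n + 1) * (mode ℓ k x - a)),
    max (K * (‖ℓ‖ * k)) (K * (‖ℓ‖ + ‖ℓ‖)), fun n => ?_, fun n => ?_, fun n x y => ?_,
    fun n x => ?_, fun x => ?_⟩
  · exact contDiff_const.mul (hτ.comp (contDiff_const.mul ((contDiff_mode ℓ k).sub contDiff_const)))
  · rw [hasCompactSupport_iff_eventuallyEq, coclosedCompact_eq_cocompact]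
    have h0 : Tendsto (fun x => ((n : ℝ) + 1) * (mode ℓ k x - a)) (cocompact ℝ) (𝓝 0) := by
      have := ((tendsto_mode_cocompact ℓ k).sub_const a).const_mul ((n : ℝ) + 1)
      rwa [← ha, sub_self, mul_zero] at this
    filter_upwards [h0 (Metric.closedBall_mem_nhds 0 one_pos)] with x hx
    rw [Set.mem_preimage, mem_closedBall_zero_iff, Real.norm_eq_abs] at hx
    simp [hτ0 _ hx]
  · refine (hlip n _ _).trans ?_
    rw [sub_sub_sub_cancel_right]
    calc _ ≤ K * (‖ℓ‖ * k * ‖z x - z y‖) := by gcongr; exact abs_mode_sub_le ℓ k x y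
      _ = K * (‖ℓ‖ * k) * ‖z x - z y‖ := by ring
      _ ≤ _ := by gcongr; exact le_max_left _ _
  · have h := hlip n (mode ℓ k x - a) 0
    rw [mul_zero, hτ0 0 (by simp), mul_zero, sub_zero, sub_zero] at h
    refine h.trans (le_trans ?_ (le_max_right _ _))
    gcongr
    exact (abs_sub _ _).trans (add_le_add (abs_mode_le ℓ k x) ha_le)
  · rw [tendsto_iff_norm_sub_tendsto_zero]
    refine squeeze_zero (g := fun n : ℕ => A * ((n : ℝ) + 1)⁻¹) (fun n => norm_nonneg _)
      (fun n => ?_) ?_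
    · have hN : (0 : ℝ) < n + 1 := by positivity
      have e : ((n : ℝ) + 1)⁻¹ * τ ((n + 1) * (mode ℓ k x - a)) - (mode ℓ k x - a) =
          (τ ((n + 1) * (mode ℓ k x - a)) - (n + 1) * (mode ℓ k x - a)) * ((n : ℝ) + 1)⁻¹ := by
        field_simp
      rw [e, norm_mul, norm_inv, Real.norm_of_nonneg hN.le]
      gcongr
      exact hτA _
    · have := (tendsto_one_div_add_atTop_nhds_zero_nat (𝕜 := ℝ)).const_mul A
      simpa using this

lemma tendsto_integral_mul_of_bounded {v u : ℝ → ℝ} {ψ : ℕ → ℝ → ℝ} {C : ℝ} (hv : Integrable v)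
    (hψ : ∀ n, Continuous (ψ n)) (hC : ∀ n x, |ψ n x| ≤ C)
    (hlim : ∀ x, Tendsto (fun n => ψ n x) atTop (𝓝 (u x))) :
    Tendsto (fun n => ∫ x, v x * ψ n x) atTop (𝓝 (∫ x, v x * u x)) := by
  refine tendsto_integral_of_dominated_convergence (fun x => ‖v x‖ * C)
    (fun n => hv.aestronglyMeasurable.mul (hψ n).aestronglyMeasurable) (hv.norm.mul_const C)
    (fun n => Eventually.of_forall fun x => ?_)
    (Eventually.of_forall fun x => (hlim x).const_mul _)
  rw [norm_mul]
  gcongr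
  exact hC n x

/-- A chordal Lipschitz constant common to all `n` supplies a single `L²` majorant for the
difference quotients. -/
lemma tendsto_energy {φ u : ℝ → ℝ} {ψ : ℕ → ℝ → ℝ} {C : ℝ} (hm : StronglyMeasurable φ)
    (hE : MemLp (diffQuot φ) 2) (hψ : ∀ n, Continuous (ψ n))
    (hC : ∀ n x y, |ψ n x - ψ n y| ≤ C * ‖z x - z y‖)
    (hlim : ∀ x, Tendsto (fun n => ψ n x) atTop (𝓝 (u x))) :
    Tendsto (fun n => energy φ (ψ n)) atTop (𝓝 (energy φ u)) := by
  refine Tendsto.const_mul _ ?_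
  refine tendsto_integral_of_dominated_convergence
    (fun p => ‖diffQuot φ p‖ * (C * √(w p.1 * w p.2)))
    (fun n => ((measurable_diffQuot hm.measurable).mul
      (measurable_diffQuot (hψ n).measurable)).aestronglyMeasurable)
    (hE.norm.integrable_mul (memLp_sqrt_w_mul_w.const_mul C))
    (fun n => Eventually.of_forall fun p => ?_)
    (Eventually.of_forall fun p => ((((hlim p.1).sub (hlim p.2)).div_const _).const_mul _))
  rw [norm_mul]
  gcongr
  exact abs_diffQuot_le (hC n) p

/-! ### Equations for the Fourier coefficients. -/

lemma stronglyMeasurable_R (m : ℕ) {φ : ℝ → ℝ} (hm : StronglyMeasurable φ) :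
    StronglyMeasurable (R m φ) := by
  unfold R
  refine StronglyMeasurable.const_mul ?_ _
  refine StronglyMeasurable.integral_prod_right (f := fun x y => kernel m x y * φ y) ?_
  exact ((measurable_kernel m).mul (hm.measurable.comp measurable_snd)).stronglyMeasurable

lemma abs_kernel_mul_le (m : ℕ) (φ : ℝ → ℝ) (x y : ℝ) :
    |kernel m x y * φ y| ≤ (m : ℝ) ^ 2 * (w x * |w y * φ y|) := by
  rw [abs_mul, abs_of_nonneg (kernel_nonneg m x y), abs_mul, abs_of_pos (w_pos y)]
  calc _ ≤ (m : ℝ) ^ 2 * (w x * w y) * |φ y| := by gcongr; exact kernel_le_w_mul_w m x y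
    _ = _ := by ring

lemma integrable_R (m : ℕ) {φ : ℝ → ℝ} (hφ : MemLHalf φ) (hm : StronglyMeasurable φ) :
    Integrable (R m φ) := by
  refine (integrable_w.const_mul ((2 * Real.pi)⁻¹ * ((m : ℝ) ^ 2 * ∫ y, ‖w y * φ y‖))).mono'
    (stronglyMeasurable_R m hm).aestronglyMeasurable (Eventually.of_forall fun x => ?_)
  unfold R
  rw [norm_mul, Real.norm_of_nonneg (by positivity : 0 ≤ (2 * Real.pi)⁻¹)]
  have h := norm_integral_le_of_norm_le (f := fun y => kernel m x y * φ y)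
    ((hφ.integrable_w_mul.norm.const_mul (w x)).const_mul ((m : ℝ) ^ 2))
    (Eventually.of_forall fun y => abs_kernel_mul_le m φ x y)
  rw [integral_const_mul, integral_const_mul] at h
  calc _ ≤ (2 * Real.pi)⁻¹ * ((m : ℝ) ^ 2 * (w x * ∫ y, ‖w y * φ y‖)) := by gcongr
    _ = _ := by ring

/-- Symmetry of the kernel and Fubini; the point is to move `R` onto a mode, where it is diagonal.
-/
lemma integral_R_mul (m : ℕ) {φ u : ℝ → ℝ} (hφ : MemLHalf φ) (hm : StronglyMeasurable φ)
    (hu : Continuous u) {C : ℝ} (hC : ∀ x, |u x| ≤ C) :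
    ∫ x, R m φ x * u x = ∫ x, φ x * R m u x := by
  have hI : Integrable (fun p : ℝ × ℝ => kernel m p.1 p.2 * φ p.2 * u p.1)
      (volume.prod volume) := by
    refine (((integrable_w.mul_prod hφ.integrable_w_mul.norm).const_mul ((m : ℝ) ^ 2)).mul_const
      C).mono' (((measurable_kernel m).mul (hm.measurable.comp measurable_snd)).mul
        (hu.measurable.comp measurable_fst)).aestronglyMeasurable (Eventually.of_forall fun p => ?_)
    rw [norm_mul]
    exact mul_le_mul (abs_kernel_mul_le m φ p.1 p.2) (hC p.1) (norm_nonneg _)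
      ((abs_nonneg _).trans (abs_kernel_mul_le m φ p.1 p.2))
  have h := integral_integral_swap (f := fun x y => kernel m x y * φ y * u x) hI
  unfold R
  have e1 (x : ℝ) : (2 * Real.pi)⁻¹ * (∫ y, kernel m x y * φ y) * u x =
      (2 * Real.pi)⁻¹ * ∫ y, kernel m x y * φ y * u x := by
    rw [integral_mul_const]; ring
  have e2 (y : ℝ) : φ y * ((2 * Real.pi)⁻¹ * ∫ x, kernel m y x * u x) =
      (2 * Real.pi)⁻¹ * ∫ x, kernel m x y * φ y * u x := by
    rw [mul_left_comm, ← integral_const_mul]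
    congr 2; funext x
    rw [kernel_comm]; ring
  simp only [e1, e2]
  rw [integral_const_mul, integral_const_mul, h]

lemma integral_R_mul_mode (m : ℕ) (ℓ : ℂ →L[ℝ] ℝ) (k : ℕ) {φ : ℝ → ℝ} (hφ : MemLHalf φ)
    (hm : StronglyMeasurable φ) :
    ∫ x, R m φ x * mode ℓ k x = (m - k : ℕ) * ∫ x, w x * φ x * mode ℓ k x := by
  rw [integral_R_mul m hφ hm (continuous_mode ℓ k) (abs_mode_le ℓ k), ← integral_const_mul]
  congr 1; funext x
  rw [R_mode]
  ring

lemma mode_re_zero (x : ℝ) : mode Complex.reCLM 0 x = 1 := by simp [mode]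

lemma integral_R (m : ℕ) {φ : ℝ → ℝ} (hφ : MemLHalf φ) (hm : StronglyMeasurable φ) :
    ∫ x, R m φ x = m * ∫ x, w x * φ x := by
  simpa [mode_re_zero] using integral_R_mul_mode m Complex.reCLM 0 hφ hm

lemma Lplus_eq (m : ℕ) {φ ψ : ℝ → ℝ} (hφ : MemLHalf φ) (hm : StronglyMeasurable φ)
    (hE : MemLp (diffQuot φ) 2) (hψ : ContDiff ℝ (⊤ : ℕ∞) ψ) (hc : HasCompactSupport ψ) :
    Lplus m φ ψ = energy φ ψ - m * ∫ x, w x * φ x * ψ x := by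
  unfold Lplus
  rw [integral_mul_absNabla hφ hm hE hψ hc, ← integral_const_mul]
  congr 2; funext x
  rw [norm_deriv_Q]
  ring

lemma energy_sub_const (φ u : ℝ → ℝ) (c : ℝ) : energy φ (fun x => u x - c) = energy φ u := by
  unfold energy diffQuot
  simp only [sub_sub_sub_cancel_right]

lemma integral_mul_mode_sub_const {v : ℝ → ℝ} (hv : Integrable v) (ℓ : ℂ →L[ℝ] ℝ) (k : ℕ) (c : ℝ) :
    ∫ x, v x * (mode ℓ k x - c) = (∫ x, v x * mode ℓ k x) - c * ∫ x, v x := by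
  have h1 : Integrable fun x => v x * mode ℓ k x :=
    hv.mul_bdd (c := ‖ℓ‖) (continuous_mode ℓ k).aestronglyMeasurable
      (Eventually.of_forall (abs_mode_le ℓ k))
  rw [← integral_const_mul, ← integral_sub h1 (hv.const_mul c)]
  congr 1; funext x
  ring

/-- The equation `L₊ φ = 0`, tested against `ℓ (z ^ k) - ℓ (i ^ k)`. -/
lemma Lplus_coeff (m : ℕ) {φ : ℝ → ℝ} (hφ : MemLHalf φ) (hm : StronglyMeasurable φ)
    (hE : MemLp (diffQuot φ) 2)
    (h : ∀ ψ : ℝ → ℝ, ContDiff ℝ (⊤ : ℕ∞) ψ → HasCompactSupport ψ → Lplus m φ ψ = 0)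
    (ℓ : ℂ →L[ℝ] ℝ) (k : ℕ) :
    ((k : ℝ) - m) * (∫ x, w x * φ x * mode ℓ k x) +
      m * (ℓ (Complex.I ^ k) * ∫ x, w x * φ x) = 0 := by
  obtain ⟨ψ, C, h1, h2, h3, h4, h5⟩ := exists_test_sequence ℓ k
  have l1 := tendsto_energy hm hE (fun n => (h1 n).continuous) h3 h5
  have l2 := tendsto_integral_mul_of_bounded hφ.integrable_w_mul (fun n => (h1 n).continuous) h4 h5
  have l := l1.sub (l2.const_mul (m : ℝ))
  have h0 (n : ℕ) : energy φ (ψ n) - m * ∫ x, w x * φ x * ψ n x = 0 := by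
    rw [← Lplus_eq m hφ hm hE (h1 n) (h2 n)]
    exact h _ (h1 n) (h2 n)
  simp only [h0] at l
  have e := tendsto_nhds_unique l tendsto_const_nhds
  -- The constant drops out of the energy but not out of the potential term, which produces the
  -- additional mean of `φ`.
  rw [energy_sub_const, energy_mode ℓ k hφ hm hE,
    integral_mul_mode_sub_const hφ.integrable_w_mul] at e
  linarith

/-- The equation `L₋ φ = 0`, tested against `ℓ (z ^ k) - ℓ (i ^ k)`. -/
lemma Lminus_coeff (m : ℕ) {φ : ℝ → ℝ} (hφ : MemLHalf φ) (hm : StronglyMeasurable φ)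
    (hE : MemLp (diffQuot φ) 2)
    (h : ∀ ψ : ℝ → ℝ, ContDiff ℝ (⊤ : ℕ∞) ψ → HasCompactSupport ψ → Lminus m φ ψ = 0)
    (ℓ : ℂ →L[ℝ] ℝ) (k : ℕ) :
    ((k : ℝ) - m + (m - k : ℕ)) * (∫ x, w x * φ x * mode ℓ k x) = 0 := by
  obtain ⟨ψ, C, h1, h2, h3, h4, h5⟩ := exists_test_sequence ℓ k
  have hR := integrable_R m hφ hm
  have l1 := tendsto_energy hm hE (fun n => (h1 n).continuous) h3 h5
  have l2 := tendsto_integral_mul_of_bounded hφ.integrable_w_mul (fun n => (h1 n).continuous) h4 h5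
  have l3 := tendsto_integral_mul_of_bounded hR (fun n => (h1 n).continuous) h4 h5
  have l := (l1.sub (l2.const_mul (m : ℝ))).add l3
  have h0 (n : ℕ) : energy φ (ψ n) - m * (∫ x, w x * φ x * ψ n x) + ∫ x, R m φ x * ψ n x = 0 := by
    rw [← Lplus_eq m hφ hm hE (h1 n) (h2 n)]
    exact h _ (h1 n) (h2 n)
  simp only [h0] at l
  have e := tendsto_nhds_unique l tendsto_const_nhds
  -- Here the constant contributes `m ∫ w φ` from the potential and `-∫ R φ`, each times `ℓ (i ^
  -- k)`; these cancel by `integral_R`.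
  rw [energy_sub_const, energy_mode ℓ k hφ hm hE,
    integral_mul_mode_sub_const hφ.integrable_w_mul, integral_mul_mode_sub_const hR,
    integral_R_mul_mode m ℓ k hφ hm, integral_R m hφ hm] at e
  linarith

/-! ### The modes as explicit solutions. -/

lemma memLHalf_of_bounded {φ : ℝ → ℝ} (hφ : Continuous φ) {C : ℝ} (hC : ∀ x, |φ x| ≤ C) :
    MemLHalf φ := by
  refine (integrable_inv_one_add_sq.bdd_mul (c := C) hφ.aestronglyMeasurable
    (Eventually.of_forall hC)).congr (Eventually.of_forall fun x => ?_)
  simp [div_eq_mul_inv]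

lemma memLHalf_mode (ℓ : ℂ →L[ℝ] ℝ) (k : ℕ) : MemLHalf (mode ℓ k) :=
  memLHalf_of_bounded (continuous_mode ℓ k) (abs_mode_le ℓ k)

lemma memLp_diffQuot_mode (ℓ : ℂ →L[ℝ] ℝ) (k : ℕ) : MemLp (diffQuot (mode ℓ k)) 2 :=
  memLp_diffQuot_of_chordal (continuous_mode ℓ k).measurable (abs_mode_sub_le ℓ k)

lemma Lplus_mode (m : ℕ) (ℓ : ℂ →L[ℝ] ℝ) (k : ℕ) {ψ : ℝ → ℝ}
    (hψ : ContDiff ℝ (⊤ : ℕ∞) ψ) (hc : HasCompactSupport ψ) :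
    Lplus m (mode ℓ k) ψ = ((k : ℝ) - m) * ∫ x, w x * mode ℓ k x * ψ x := by
  obtain ⟨C, hC⟩ := exists_chordal_bound hψ hc
  obtain ⟨A, hA⟩ := hc.exists_bound_of_continuous hψ.continuous
  -- The energy is symmetric, so `energy_mode` applies with the test function in the role of `φ`.
  rw [Lplus_eq m (memLHalf_mode ℓ k) (continuous_mode ℓ k).stronglyMeasurable
    (memLp_diffQuot_mode ℓ k) hψ hc, energy_comm, energy_mode ℓ k
    (memLHalf_of_bounded hψ.continuous hA) hψ.continuous.stronglyMeasurable
    (memLp_diffQuot_of_chordal hψ.continuous.measurable hC), sub_mul]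
  simp only [mul_right_comm (w _)]

lemma Lminus_mode (m : ℕ) (ℓ : ℂ →L[ℝ] ℝ) (k : ℕ) {ψ : ℝ → ℝ}
    (hψ : ContDiff ℝ (⊤ : ℕ∞) ψ) (hc : HasCompactSupport ψ) :
    Lminus m (mode ℓ k) ψ =
      ((k : ℝ) - m + (m - k : ℕ)) * ∫ x, w x * mode ℓ k x * ψ x := by
  unfold Lminus
  rw [Lplus_mode m ℓ k hψ hc, add_mul, ← integral_const_mul ((m - k : ℕ) : ℝ)]
  simp only [R_mode, mul_assoc]

/-! ### Completeness of the trigonometric system. -/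

/-- `z` as a bounded continuous function. -/
def zBCF : BoundedContinuousFunction ℝ ℂ :=
  BoundedContinuousFunction.ofNormedAddCommGroup z continuous_z 1 fun x => (norm_z x).le

lemma zBCF_apply (x : ℝ) : zBCF x = z x := rfl

/-- The algebra of trigonometric polynomials on the circle, in the coordinate `x`. -/
def trigAlgebra : StarSubalgebra ℂ (BoundedContinuousFunction ℝ ℂ) := StarAlgebra.adjoin ℂ {zBCF}

/-- On the circle the adjoint of `z` is `z⁻¹`, so the monomials in `z` and its adjoint are the
integer powers of `z`. -/
lemma mem_span_of_mem_trigAlgebra {q : BoundedContinuousFunction ℝ ℂ} (hq : q ∈ trigAlgebra) :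
    q ∈ Submodule.span ℂ {p : BoundedContinuousFunction ℝ ℂ | ∃ n : ℤ, ∀ x, p x = z x ^ n} := by
  have h : q ∈ Algebra.adjoin ℂ ({zBCF} ∪ star {zBCF} : Set (BoundedContinuousFunction ℝ ℂ)) := by
    rw [← StarAlgebra.adjoin_toSubalgebra]
    exact hq
  rw [← Subalgebra.mem_toSubmodule, Algebra.adjoin_eq_span] at h
  refine Submodule.span_mono ?_ h
  intro p hp
  induction hp using Submonoid.closure_induction with
  | mem p hp =>
    rcases hp with hp | hp
    · rw [Set.mem_singleton_iff.mp hp]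
      exact ⟨1, fun x => by rw [zBCF_apply, zpow_one]⟩
    · rw [Set.mem_star, Set.mem_singleton_iff, star_eq_iff_star_eq] at hp
      refine ⟨-1, fun x => ?_⟩
      rw [← hp, BoundedContinuousFunction.star_apply, zBCF_apply, zpow_neg_one, ← conj_z]
      rfl
  | one => exact ⟨0, fun x => by simp⟩
  | mul p q _ _ hp hq =>
    obtain ⟨a, ha⟩ := hp
    obtain ⟨b, hb⟩ := hq
    exact ⟨a + b, fun x => by
      rw [BoundedContinuousFunction.mul_apply, ha, hb, zpow_add₀ (z_ne_zero x)]⟩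

lemma trigAlgebra_separatesPoints :
    (trigAlgebra.map (BoundedContinuousFunction.toContinuousMapStarₐ ℂ)).SeparatesPoints := by
  intro x y hxy
  refine ⟨z, ⟨⟨z, continuous_z⟩, ⟨zBCF, StarAlgebra.self_mem_adjoin_singleton ℂ _, rfl⟩, rfl⟩, ?_⟩
  exact fun h => hxy (z_injective h)

/-- Negative powers follow by complex conjugation because `v` is real. -/
lemma integral_ofReal_mul_zpow_eq_zero {v : ℝ → ℝ} (hv : Integrable v)
    (hf : ∀ k, ∫ x, v x * f k x = 0) (hg : ∀ k, ∫ x, v x * g k x = 0) (n : ℤ) :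
    ∫ x, (v x : ℂ) * z x ^ n = 0 := by
  have hi (n : ℤ) : Integrable fun x => (v x : ℂ) * z x ^ n :=
    (hv.ofReal (𝕜 := ℂ)).mul_bdd (c := 1) (continuous_z_zpow n).aestronglyMeasurable
      (Eventually.of_forall fun x => (norm_z_zpow x n).le)
  have hnat (k : ℕ) : ∫ x, (v x : ℂ) * z x ^ k = 0 := by
    have hk : Integrable fun x => (v x : ℂ) * z x ^ k := by simpa using hi k
    have hre := Complex.reCLM.integral_comp_comm hk
    have him := Complex.imCLM.integral_comp_comm hk
    simp only [Complex.reCLM_apply, Complex.imCLM_apply, Complex.re_ofReal_mul,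
      Complex.im_ofReal_mul] at hre him
    exact Complex.ext (hre.symm.trans (hf k)) (him.symm.trans (hg k))
  obtain ⟨k, rfl | rfl⟩ := n.eq_nat_or_neg
  · simpa using hnat k
  · have h := congrArg (starRingEnd ℂ) (hnat k)
    rw [← integral_conj, map_zero] at h
    simpa [conj_z] using h

/-- Since `v` is merely integrable, the argument runs through measures: the positive and negative
parts of `v` are densities of finite measures with equal integrals over a point-separating star
algebra of bounded continuous functions. Such measures coincide, so the two parts agree almost
everywhere. -/
lemma ae_eq_zero_of_integral_mul_eq_zero {v : ℝ → ℝ} (hv : Integrable v) (hm : Measurable v)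
    (hf : ∀ k, ∫ x, v x * f k x = 0) (hg : ∀ k, ∫ x, v x * g k x = 0) : v =ᵐ[volume] 0 := by
  have hz := integral_ofReal_mul_zpow_eq_zero hv hf hg
  have hvb (q : BoundedContinuousFunction ℝ ℂ) {u : ℝ → ℝ} (hu : Integrable u) :
      Integrable fun x => (u x : ℂ) * q x :=
    (hu.ofReal (𝕜 := ℂ)).mul_bdd (c := ‖q‖) q.continuous.aestronglyMeasurable
      (Eventually.of_forall q.norm_coe_le_norm)
  have hA (q : BoundedContinuousFunction ℝ ℂ) (hq : q ∈ trigAlgebra) :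
      ∫ x, (v x : ℂ) * q x = 0 := by
    have hs := mem_span_of_mem_trigAlgebra hq
    clear hq
    induction hs using Submodule.span_induction with
    | mem p hp =>
      obtain ⟨n, hn⟩ := hp
      simp only [hn, hz]
    | zero => simp
    | add p q _ _ hp hq =>
      simp only [BoundedContinuousFunction.add_apply, mul_add]
      rw [integral_add (hvb p hv) (hvb q hv), hp, hq, add_zero]
    | smul c p _ hp =>
      simp only [BoundedContinuousFunction.smul_apply, smul_eq_mul, mul_left_comm _ c]
      rw [integral_const_mul, hp, mul_zero]
  have hfin1 : IsFiniteMeasure (volume.withDensity fun x => ENNReal.ofReal (v x)) :=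
    isFiniteMeasure_withDensity_ofReal hv.2
  have hfin2 : IsFiniteMeasure (volume.withDensity fun x => ENNReal.ofReal (-v x)) :=
    isFiniteMeasure_withDensity_ofReal hv.neg.2
  have hm1 : Measurable fun x => ENNReal.ofReal (v x) := hm.ennreal_ofReal
  have hm2 : Measurable fun x => ENNReal.ofReal (-v x) := hm.neg.ennreal_ofReal
  have hmeas : (volume.withDensity fun x => ENNReal.ofReal (v x)) =
      volume.withDensity fun x => ENNReal.ofReal (-v x) := by
    refine ext_of_forall_mem_subalgebra_integral_eq_of_pseudoEMetric_complete_countable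
      trigAlgebra_separatesPoints fun q hq => ?_
    rw [integral_withDensity_eq_integral_toReal_smul hm1 (by simp),
      integral_withDensity_eq_integral_toReal_smul hm2 (by simp), ← sub_eq_zero]
    have e (u : ℝ → ℝ) (x : ℝ) : (ENNReal.ofReal (u x)).toReal • q x = (max (u x) 0 : ℝ) * q x := by
      rw [ENNReal.toReal_ofReal', Complex.real_smul]
    have e' := e fun x => -v x
    simp only [e v, e']
    rw [← integral_sub (hvb q hv.pos_part) (hvb q hv.neg_part), ← hA q hq]
    congr 1; funext x
    rw [← sub_mul, ← Complex.ofReal_sub, max_zero_sub_max_neg_zero_eq_self]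
  have hae := (withDensity_eq_iff hm1.aemeasurable hm2.aemeasurable
    (by
      have := measure_ne_top (volume.withDensity fun x => ENNReal.ofReal (v x)) Set.univ
      rwa [withDensity_apply _ MeasurableSet.univ, Measure.restrict_univ] at this)).mp hmeas
  filter_upwards [hae] with x hx
  have h := congrArg ENNReal.toReal hx
  rw [ENNReal.toReal_ofReal', ENNReal.toReal_ofReal'] at h
  have := max_zero_sub_max_neg_zero_eq_self (v x)
  rw [h, sub_self] at this
  exact this.symm

/-! ### The orthogonal basis -/

/-- The functional `Re` for `n ≥ 0` and `Im` for `n < 0`. -/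
def part (n : ℤ) : ℂ →L[ℝ] ℝ := if 0 ≤ n then Complex.reCLM else Complex.imCLM

/-- The real trigonometric system: `f n` for `n ≥ 0` and `g |n|` for `n < 0`. -/
def trig (n : ℤ) : ℝ → ℝ := mode (part n) n.natAbs

lemma trig_natCast (k : ℕ) : trig k = f k := by
  simp [trig, part, f_eq_mode]

lemma trig_neg_natCast {k : ℕ} (hk : 1 ≤ k) : trig (-(k : ℤ)) = g k := by
  have : ¬ (0 : ℤ) ≤ -(k : ℤ) := by omega
  simp only [trig, part, if_neg this, g_eq_mode, Int.natAbs_neg, Int.natAbs_natCast]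

lemma continuous_trig (n : ℤ) : Continuous (trig n) := continuous_mode _ _

lemma integral_w_mul_re (n : ℤ) : ∫ x, w x * (z x ^ n).re = if n = 0 then 2 * Real.pi else 0 := by
  have h := Complex.reCLM.integral_comp_comm (integrable_w_mul_zpow n)
  simp only [Complex.reCLM_apply, Complex.re_ofReal_mul, integral_w_mul_zpow] at h
  rw [h]
  split_ifs <;> simp

lemma integral_w_mul_im (n : ℤ) : ∫ x, w x * (z x ^ n).im = 0 := by
  have h := Complex.imCLM.integral_comp_comm (integrable_w_mul_zpow n)
  simp only [Complex.imCLM_apply, Complex.im_ofReal_mul, integral_w_mul_zpow] at h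
  rw [h]
  split_ifs <;> simp

lemma integrable_w_mul_re (n : ℤ) : Integrable fun x => w x * (z x ^ n).re := by
  simpa using (integrable_w_mul_zpow n).re

lemma integrable_w_mul_im (n : ℤ) : Integrable fun x => w x * (z x ^ n).im := by
  simpa using (integrable_w_mul_zpow n).im

lemma z_zpow_sub (x : ℝ) (j k : ℕ) :
    z x ^ ((j : ℤ) - k) = z x ^ j * (starRingEnd ℂ) (z x ^ k) := by
  rw [zpow_sub₀ (z_ne_zero x), map_pow, conj_z, inv_pow, zpow_natCast, zpow_natCast]
  rfl

lemma z_zpow_add (x : ℝ) (j k : ℕ) : z x ^ ((j : ℤ) + k) = z x ^ j * z x ^ k := by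
  rw [zpow_add₀ (z_ne_zero x), zpow_natCast, zpow_natCast]

/-- Product-to-sum formula. Both indicators are active for `j = k = 0`, so the constant has twice
the squared norm of the other modes. -/
lemma integral_w_mul_f_mul_f (j k : ℕ) : ∫ x, w x * f j x * f k x =
    ((if (j : ℤ) + k = 0 then 2 * Real.pi else 0) +
      if (j : ℤ) - k = 0 then 2 * Real.pi else 0) / 2 := by
  rw [← integral_w_mul_re, ← integral_w_mul_re,
    ← integral_add (integrable_w_mul_re _) (integrable_w_mul_re _), ← integral_div]
  congr 1; funext x
  rw [z_zpow_add, z_zpow_sub]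
  simp only [f, Complex.mul_re, Complex.conj_re, Complex.conj_im]
  ring

lemma integral_w_mul_g_mul_g (j k : ℕ) : ∫ x, w x * g j x * g k x =
    ((if (j : ℤ) - k = 0 then 2 * Real.pi else 0) -
      if (j : ℤ) + k = 0 then 2 * Real.pi else 0) / 2 := by
  rw [← integral_w_mul_re, ← integral_w_mul_re,
    ← integral_sub (integrable_w_mul_re _) (integrable_w_mul_re _), ← integral_div]
  congr 1; funext x
  rw [z_zpow_add, z_zpow_sub]
  simp only [g, Complex.mul_re, Complex.conj_re, Complex.conj_im]
  ring

lemma integral_w_mul_f_mul_g (j k : ℕ) : ∫ x, w x * f j x * g k x = 0 := by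
  have h : ∫ x, w x * f j x * g k x =
      ((∫ x, w x * (z x ^ ((j : ℤ) + k)).im) - ∫ x, w x * (z x ^ ((j : ℤ) - k)).im) / 2 := by
    rw [← integral_sub (integrable_w_mul_im _) (integrable_w_mul_im _), ← integral_div]
    congr 1; funext x
    rw [z_zpow_add, z_zpow_sub]
    simp only [f, g, Complex.mul_im, Complex.conj_re, Complex.conj_im]
    ring
  rw [h, integral_w_mul_im, integral_w_mul_im]
  norm_num

lemma int_cases (n : ℤ) : (∃ k : ℕ, n = k) ∨ ∃ k : ℕ, 1 ≤ k ∧ n = -(k : ℤ) := by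
  rcases le_or_gt 0 n with h | h
  · exact Or.inl ⟨n.toNat, by omega⟩
  · exact Or.inr ⟨(-n).toNat, by omega, by omega⟩

lemma integral_trig_mul_trig_of_ne {i j : ℤ} (h : i ≠ j) : ∫ x, w x * trig i x * trig j x = 0 := by
  rcases int_cases i with ⟨a, rfl⟩ | ⟨a, ha, rfl⟩ <;> rcases int_cases j with ⟨b, rfl⟩ | ⟨b, hb, rfl⟩
  · rw [trig_natCast, trig_natCast, integral_w_mul_f_mul_f, if_neg (by omega), if_neg (by omega)]
    norm_num
  · rw [trig_natCast, trig_neg_natCast hb, integral_w_mul_f_mul_g]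
  · rw [trig_natCast, trig_neg_natCast ha]
    simp only [mul_right_comm (w _)]
    exact integral_w_mul_f_mul_g b a
  · rw [trig_neg_natCast ha, trig_neg_natCast hb, integral_w_mul_g_mul_g, if_neg (by omega),
      if_neg (by omega)]
    norm_num

lemma integral_trig_mul_self_pos (i : ℤ) : 0 < ∫ x, w x * trig i x * trig i x := by
  have := Real.pi_pos
  rcases int_cases i with ⟨a, rfl⟩ | ⟨a, ha, rfl⟩
  · rw [trig_natCast, integral_w_mul_f_mul_f, if_pos (sub_self (a : ℤ))]
    split_ifs <;> linarith
  · rw [trig_neg_natCast ha, integral_w_mul_g_mul_g, if_pos (sub_self (a : ℤ)), if_neg (by omega)]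
    linarith

/-- The class of `ℓ (z ^ k)` modulo null sets. -/
def modeClass (ℓ : ℂ →L[ℝ] ℝ) (k : ℕ) : ℝ →ₘ[volume] ℝ :=
  AEEqFun.mk (mode ℓ k) (continuous_mode ℓ k).aestronglyMeasurable

lemma modeClass_ae_eq (ℓ : ℂ →L[ℝ] ℝ) (k : ℕ) :
    (modeClass ℓ k : ℝ → ℝ) =ᵐ[volume] mode ℓ k := AEEqFun.coeFn_mk _ _

lemma modeClass_mem_HdotHalf (ℓ : ℂ →L[ℝ] ℝ) (k : ℕ) : modeClass ℓ k ∈ HdotHalf := by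
  have e := modeClass_ae_eq ℓ k
  refine ⟨(memLHalf_mode ℓ k).congr e.symm, ?_⟩
  rw [seminormSq_congr e, seminormSq_lt_top_iff (continuous_mode ℓ k).measurable]
  exact memLp_diffQuot_mode ℓ k

/-- The class of `trig n` as an element of `Ḣ^{1/2}(ℝ)`. -/
def trigClass (n : ℤ) : HdotHalf := ⟨modeClass (part n) n.natAbs, modeClass_mem_HdotHalf _ _⟩

lemma trigClass_ae_eq (n : ℤ) : ((trigClass n : ℝ →ₘ[volume] ℝ) : ℝ → ℝ) =ᵐ[volume] trig n :=
  AEEqFun.coeFn_mk _ _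

lemma coe_trigClass_natCast (k : ℕ) : (trigClass k : ℝ →ₘ[volume] ℝ) = fClass k := by
  refine AEEqFun.ext ((trigClass_ae_eq _).trans ?_)
  rw [trig_natCast]
  exact (AEEqFun.coeFn_mk _ _).symm

lemma coe_trigClass_neg_natCast {k : ℕ} (hk : 1 ≤ k) :
    (trigClass (-(k : ℤ)) : ℝ →ₘ[volume] ℝ) = gClass k := by
  refine AEEqFun.ext ((trigClass_ae_eq _).trans ?_)
  rw [trig_neg_natCast hk]
  exact (AEEqFun.coeFn_mk _ _).symm

lemma HdotHalf_integrable_trig (φ : HdotHalf) (n : ℤ) :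
    Integrable fun x => w x * (φ : ℝ →ₘ[volume] ℝ) x * trig n x :=
  MemLHalf.integrable_w_mul_mul φ.2.1 (continuous_trig n) (abs_mode_le _ _)

/-- The (unnormalized) Fourier coefficients. -/
def coeff (n : ℤ) : HdotHalf →ₗ[ℝ] ℝ where
  toFun φ := ∫ x, w x * (φ : ℝ →ₘ[volume] ℝ) x * trig n x
  map_add' φ ψ := by
    rw [← integral_add (HdotHalf_integrable_trig φ n) (HdotHalf_integrable_trig ψ n)]
    refine integral_congr_ae ?_
    filter_upwards [AEEqFun.coeFn_add (φ : ℝ →ₘ[volume] ℝ) ψ] with x hx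
    rw [Submodule.coe_add, hx, Pi.add_apply]
    ring
  map_smul' c φ := by
    rw [RingHom.id_apply, smul_eq_mul, ← integral_const_mul]
    refine integral_congr_ae ?_
    filter_upwards [AEEqFun.coeFn_smul c (φ : ℝ →ₘ[volume] ℝ)] with x hx
    rw [Submodule.coe_smul, hx, Pi.smul_apply, smul_eq_mul]
    ring

lemma coeff_apply (n : ℤ) (φ : HdotHalf) :
    coeff n φ = ∫ x, w x * (φ : ℝ →ₘ[volume] ℝ) x * trig n x := rfl

lemma coeff_trigClass (i j : ℤ) : coeff i (trigClass j) = ∫ x, w x * trig j x * trig i x := by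
  refine integral_congr_ae ?_
  filter_upwards [trigClass_ae_eq j] with x hx
  rw [hx]

lemma coeff_trigClass_of_ne {i j : ℤ} (h : i ≠ j) : coeff i (trigClass j) = 0 := by
  rw [coeff_trigClass, integral_trig_mul_trig_of_ne h.symm]

lemma coeff_trigClass_self (i : ℤ) : coeff i (trigClass i) ≠ 0 := by
  rw [coeff_trigClass]
  exact (integral_trig_mul_self_pos i).ne'

lemma eq_zero_of_coeff_eq_zero (φ : HdotHalf) (h : ∀ n, coeff n φ = 0) : φ = 0 := by
  have hm := (φ : ℝ →ₘ[volume] ℝ).stronglyMeasurable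
  have hv := ae_eq_zero_of_integral_mul_eq_zero (MemLHalf.integrable_w_mul φ.2.1)
    (continuous_w.measurable.mul hm.measurable)
    (fun k => by
      have := h k
      rwa [coeff_apply, trig_natCast] at this)
    (fun k => by
      -- The index `0` of `trig` belongs to `f 0`; `g 0` has no index of its own and is identically
      -- zero.
      rcases Nat.eq_zero_or_pos k with rfl | hk
      · simp [g]
      · have := h (-(k : ℤ))
        rwa [coeff_apply, trig_neg_natCast hk] at this)
  refine Subtype.ext (AEEqFun.ext ?_)
  refine EventuallyEq.trans ?_ AEEqFun.coeFn_zero.symm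
  filter_upwards [hv] with x hx
  exact (mul_eq_zero.mp hx).resolve_left (w_pos x).ne'

lemma linearIndependent_trigClass : LinearIndependent ℝ trigClass := by
  rw [linearIndependent_iff']
  intro S c hc i hi
  have h := congrArg (coeff i) hc
  rw [map_sum, map_zero, Finset.sum_eq_single i] at h
  · rw [map_smul, smul_eq_mul] at h
    exact (mul_eq_zero.mp h).resolve_right (coeff_trigClass_self i)
  · intro j _ hj
    rw [map_smul, coeff_trigClass_of_ne hj.symm, smul_zero]
  · exact fun h => absurd hi h

/-- By orthogonality the difference of the two sides has no nonzero coefficient, so completeness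
applies; as `S` is finite, no convergence of Fourier series is involved. -/
lemma eq_sum_trigClass (S : Finset ℤ) (φ : HdotHalf) (h : ∀ n ∉ S, coeff n φ = 0) :
    φ = ∑ n ∈ S, (coeff n φ / coeff n (trigClass n)) • trigClass n := by
  rw [← sub_eq_zero]
  refine eq_zero_of_coeff_eq_zero _ fun i => ?_
  rw [map_sub, map_sum]
  by_cases hi : i ∈ S
  · rw [Finset.sum_eq_single_of_mem i hi fun j _ hj => by
      rw [map_smul, coeff_trigClass_of_ne hj.symm, smul_zero], map_smul, smul_eq_mul,
      div_mul_cancel₀ _ (coeff_trigClass_self i), sub_self]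
  · rw [h i hi, Finset.sum_eq_zero, sub_self]
    intro j hj
    rw [map_smul, coeff_trigClass_of_ne (ne_of_mem_of_not_mem hj hi).symm, smul_zero]

/-- A space that is described by its frequencies is spanned by the corresponding functions. -/
lemma eq_span_trigClass (S : Finset ℤ) (N : Submodule ℝ (ℝ →ₘ[volume] ℝ)) (hN : N ≤ HdotHalf)
    (h1 : ∀ n ∈ S, (trigClass n : ℝ →ₘ[volume] ℝ) ∈ N)
    (h2 : ∀ φ : HdotHalf, (φ : ℝ →ₘ[volume] ℝ) ∈ N → ∀ n ∉ S, coeff n φ = 0) :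
    N = Submodule.span ℝ ((fun n => (trigClass n : ℝ →ₘ[volume] ℝ)) '' (S : Set ℤ)) := by
  refine le_antisymm (fun φ hφ => ?_) (Submodule.span_le.mpr ?_)
  · have h := congrArg (Subtype.val) (eq_sum_trigClass S ⟨φ, hN hφ⟩ (h2 ⟨φ, hN hφ⟩ hφ))
    simp only [AddSubmonoidClass.coe_finsetSum, Submodule.coe_smul] at h
    rw [h]
    exact Submodule.sum_mem _ fun n hn =>
      Submodule.smul_mem _ _ (Submodule.subset_span ⟨n, hn, rfl⟩)
  · rintro _ ⟨n, hn, rfl⟩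
    exact h1 n hn

lemma finrank_span_trigClass (S : Finset ℤ) :
    Module.finrank ℝ (Submodule.span ℝ
      ((fun n => (trigClass n : ℝ →ₘ[volume] ℝ)) '' (S : Set ℤ))) = S.card := by
  have hli : LinearIndependent ℝ fun n => (trigClass n : ℝ →ₘ[volume] ℝ) :=
    linearIndependent_trigClass.map' HdotHalf.subtype HdotHalf.ker_subtype
  have := finrank_span_eq_card (hli.comp (Subtype.val : S → ℤ) Subtype.val_injective)
  rw [Set.range_comp, Subtype.range_coe_subtype, Fintype.card_coe] at this
  exact this

/-! ### The nullspaces -/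

lemma modeClass_mem_NLplus (ℓ : ℂ →L[ℝ] ℝ) (m : ℕ) : modeClass ℓ m ∈ NLplus m := by
  refine ⟨modeClass_mem_HdotHalf ℓ m, fun ψ hψ hc => ?_⟩
  rw [Lplus_congr m (modeClass_ae_eq ℓ m), Lplus_mode m ℓ m hψ hc, sub_self, zero_mul]

lemma modeClass_mem_NLminus (ℓ : ℂ →L[ℝ] ℝ) {m k : ℕ} (hk : k ≤ m) :
    modeClass ℓ k ∈ NLminus m := by
  refine ⟨modeClass_mem_HdotHalf ℓ k, fun ψ hψ hc => ?_⟩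
  rw [Lminus_congr m (modeClass_ae_eq ℓ k), Lminus_mode m ℓ k hψ hc, Nat.cast_sub hk]
  ring

lemma coeff_eq_zero_of_mem_NLplus {m : ℕ} (hm : 1 ≤ m) (φ : HdotHalf)
    (hφ : (φ : ℝ →ₘ[volume] ℝ) ∈ NLplus m) {n : ℤ} (hn : n.natAbs ≠ m) : coeff n φ = 0 := by
  have hs := (φ : ℝ →ₘ[volume] ℝ).stronglyMeasurable
  have hE := (seminormSq_lt_top_iff hs.measurable).mp φ.2.2
  have h := Lplus_coeff m φ.2.1 hs hE hφ.2
  have hm0 : (m : ℝ) ≠ 0 := by positivity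
  -- At frequency `m` the coefficient term drops out, leaving `m ℓ (i ^ m)` times the mean for every
  -- `ℓ`. A nonzero mean would force `i ^ m = 0`.
  have hmean : ∫ x, w x * (φ : ℝ →ₘ[volume] ℝ) x = 0 := by
    by_contra hne
    have key (ℓ : ℂ →L[ℝ] ℝ) : ℓ (Complex.I ^ m) = 0 := by
      have := h ℓ m
      rw [sub_self, zero_mul, zero_add] at this
      simpa [hm0, hne] using this
    have : Complex.I ^ m = 0 := Complex.ext (key Complex.reCLM) (key Complex.imCLM)
    exact pow_ne_zero m Complex.I_ne_zero this
  have h' := h (part n) n.natAbs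
  rw [hmean, mul_zero, mul_zero, add_zero] at h'
  refine (mul_eq_zero.mp h').resolve_left (sub_ne_zero.mpr ?_)
  exact_mod_cast hn

lemma coeff_eq_zero_of_mem_NLminus {m : ℕ} (φ : HdotHalf)
    (hφ : (φ : ℝ →ₘ[volume] ℝ) ∈ NLminus m) {n : ℤ} (hn : m < n.natAbs) : coeff n φ = 0 := by
  have hs := (φ : ℝ →ₘ[volume] ℝ).stronglyMeasurable
  have hE := (seminormSq_lt_top_iff hs.measurable).mp φ.2.2
  have h := Lminus_coeff m φ.2.1 hs hE hφ.2 (part n) n.natAbs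
  refine (mul_eq_zero.mp h).resolve_left ?_
  rw [Nat.sub_eq_zero_of_le hn.le, Nat.cast_zero, add_zero]
  exact sub_ne_zero.mpr (by exact_mod_cast hn.ne')

lemma NLplus_eq_span_trigClass {m : ℕ} (hm : 1 ≤ m) : NLplus m = Submodule.span ℝ
    ((fun n => (trigClass n : ℝ →ₘ[volume] ℝ)) '' (({(m : ℤ), -(m : ℤ)} : Finset ℤ) : Set ℤ)) := by
  refine eq_span_trigClass _ _ (fun φ hφ => hφ.1) (fun n hn => ?_) (fun φ hφ n hn => ?_)
  · have : n.natAbs = m := by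
      simp only [Finset.mem_insert, Finset.mem_singleton] at hn
      omega
    have h := modeClass_mem_NLplus (part n) m
    rw [← this] at h ⊢
    exact h
  · refine coeff_eq_zero_of_mem_NLplus hm φ hφ ?_
    simp only [Finset.mem_insert, Finset.mem_singleton] at hn
    omega

lemma NLminus_eq_span_trigClass (m : ℕ) : NLminus m = Submodule.span ℝ
    ((fun n => (trigClass n : ℝ →ₘ[volume] ℝ)) '' ((Finset.Icc (-(m : ℤ)) m : Finset ℤ) : Set ℤ)) := by
  refine eq_span_trigClass _ _ (fun φ hφ => hφ.1) (fun n hn => ?_) (fun φ hφ n hn => ?_)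
  · refine modeClass_mem_NLminus (part n) ?_
    rw [Finset.mem_Icc] at hn
    omega
  · refine coeff_eq_zero_of_mem_NLminus φ hφ ?_
    rw [Finset.mem_Icc] at hn
    omega

lemma fClass_zero : fClass 0 = 1 := by
  refine AEEqFun.ext ((AEEqFun.coeFn_mk _ _).trans ?_)
  refine EventuallyEq.trans ?_ AEEqFun.coeFn_one.symm
  exact Eventually.of_forall fun x => by simp [f]

lemma image_trigClass_Icc (m : ℕ) :
    (fun n => (trigClass n : ℝ →ₘ[volume] ℝ)) '' ((Finset.Icc (-(m : ℤ)) m : Finset ℤ) : Set ℤ) =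
      {1} ∪ fClass '' Set.Icc 1 m ∪ gClass '' Set.Icc 1 m := by
  ext φ
  constructor
  · rintro ⟨n, hn, rfl⟩
    rw [Finset.mem_coe, Finset.mem_Icc] at hn
    rcases int_cases n with ⟨k, rfl⟩ | ⟨k, hk, rfl⟩
    · refine Or.inl ?_
      simp only [coe_trigClass_natCast]
      rcases Nat.eq_zero_or_pos k with rfl | hk
      · exact Or.inl fClass_zero
      · exact Or.inr ⟨k, ⟨hk, by omega⟩, rfl⟩
    · exact Or.inr ⟨k, ⟨hk, by omega⟩, (coe_trigClass_neg_natCast hk).symm⟩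
  · rintro ((h | ⟨k, hk, rfl⟩) | ⟨k, hk, rfl⟩)
    · refine ⟨((0 : ℕ) : ℤ), by simp, ?_⟩
      simp only [coe_trigClass_natCast]
      rw [Set.mem_singleton_iff.mp h, fClass_zero]
    · refine ⟨(k : ℤ), ?_, coe_trigClass_natCast k⟩
      rw [Finset.mem_coe, Finset.mem_Icc]
      have := hk.2
      omega
    · refine ⟨-(k : ℤ), ?_, coe_trigClass_neg_natCast hk.1⟩
      rw [Finset.mem_coe, Finset.mem_Icc]
      have := hk.2
      omega

/-! ### The resonance. -/

/-- A nonzero limit at infinity bounds the square from below on a half-line, which has infinite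
measure. -/
lemma modeClass_notMem_Lp {ℓ : ℂ →L[ℝ] ℝ} {k : ℕ} (h : ℓ (Complex.I ^ k) ≠ 0) :
    modeClass ℓ k ∉ Lp ℝ 2 (volume : Measure ℝ) := by
  intro hmem
  have hL : MemLp (mode ℓ k) 2 :=
    (memLp_congr_ae (modeClass_ae_eq ℓ k)).mp (Lp.mem_Lp_iff_memLp.mp hmem)
  have hsq := (memLp_two_iff_integrable_sq (continuous_mode ℓ k).aestronglyMeasurable).mp hL
  set a := ℓ (Complex.I ^ k) with ha
  have hlim : Tendsto (fun x => mode ℓ k x ^ 2) atTop (𝓝 (a ^ 2)) :=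
    ((tendsto_mode_cocompact ℓ k).mono_left atTop_le_cocompact).pow 2
  have hpos : 0 < a ^ 2 := by positivity
  obtain ⟨M, hM⟩ := eventually_atTop.mp (hlim.eventually (lt_mem_nhds (half_lt_self hpos)))
  have hconst : IntegrableOn (fun _ : ℝ => a ^ 2 / 2) (Set.Ici M) := by
    refine (hsq.integrableOn (s := Set.Ici M)).mono' aestronglyMeasurable_const ?_
    refine (ae_restrict_iff' measurableSet_Ici).mpr (Eventually.of_forall fun x hx => ?_)
    rw [Real.norm_of_nonneg (by positivity)]
    exact (hM x hx).le
  rw [integrableOn_const_iff] at hconst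
  rcases hconst with h0 | h0
  · rw [enorm_eq_zero] at h0
    linarith
  · simp at h0

lemma isResonance_modeClass {ℓ : ℂ →L[ℝ] ℝ} {m : ℕ} (h : ℓ (Complex.I ^ m) ≠ 0) :
    IsResonance (NLplus m) (modeClass ℓ m) ∧ IsResonance (NLminus m) (modeClass ℓ m) :=
  ⟨⟨modeClass_mem_NLplus ℓ m, modeClass_mem_HdotHalf ℓ m, modeClass_notMem_Lp h⟩,
    ⟨modeClass_mem_NLminus ℓ le_rfl, modeClass_mem_HdotHalf ℓ m, modeClass_notMem_Lp h⟩⟩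

end HalfHarmonic

end

theorem theorem3 (m : ℕ) (hm : 1 ≤ m) :
    HalfHarmonic.NLplus m = Submodule.span ℝ {HalfHarmonic.fClass m, HalfHarmonic.gClass m} ∧
    HalfHarmonic.NLminus m = Submodule.span ℝ
      ({1} ∪ HalfHarmonic.fClass '' Set.Icc 1 m ∪ HalfHarmonic.gClass '' Set.Icc 1 m) ∧
    Module.finrank ℝ (HalfHarmonic.NLplus m) = 2 ∧
    Module.finrank ℝ (HalfHarmonic.NLminus m) = 2 * m + 1 ∧
    HalfHarmonic.Nondegenerate m ∧
    ∃ φ : ℝ →ₘ[MeasureTheory.volume] ℝ,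
      HalfHarmonic.IsResonance (HalfHarmonic.NLplus m) φ ∧
      HalfHarmonic.IsResonance (HalfHarmonic.NLminus m) φ ∧
      (Odd m → φ = HalfHarmonic.gClass m) ∧
      (Even m → φ = HalfHarmonic.fClass m) := by
  have hplus := HalfHarmonic.NLplus_eq_span_trigClass hm
  have hminus := HalfHarmonic.NLminus_eq_span_trigClass m
  have hfplus : Module.finrank ℝ (HalfHarmonic.NLplus m) = 2 := by
    rw [hplus, HalfHarmonic.finrank_span_trigClass]
    -- The frequencies `m` and `-m` are distinct because `m ≥ 1`.
    exact Finset.card_pair (by omega)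
  have hfminus : Module.finrank ℝ (HalfHarmonic.NLminus m) = 2 * m + 1 := by
    rw [hminus, HalfHarmonic.finrank_span_trigClass, Int.card_Icc]
    omega
  refine ⟨?_, ?_, hfplus, hfminus, ⟨hfplus, hfminus⟩, ?_⟩
  · rw [hplus, Finset.coe_pair, Set.image_pair, HalfHarmonic.coe_trigClass_natCast,
      HalfHarmonic.coe_trigClass_neg_natCast hm]
  · rw [hminus, HalfHarmonic.image_trigClass_Icc]
  · rcases Nat.even_or_odd m with he | ho
    -- For even `m` the value `i ^ m` at infinity is `±1`; in the odd case below it is `±i`, so the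
    -- imaginary part takes over.
    · have h : Complex.reCLM (Complex.I ^ m) ≠ 0 := by
        obtain ⟨j, rfl⟩ := he
        rw [← two_mul, pow_mul, Complex.I_sq]
        rcases neg_one_pow_eq_or ℂ j with e | e <;> simp [e]
      obtain ⟨h1, h2⟩ := HalfHarmonic.isResonance_modeClass h
      exact ⟨_, h1, h2, fun ho => absurd ho (Nat.not_odd_iff_even.mpr he), fun _ => rfl⟩
    · have h : Complex.imCLM (Complex.I ^ m) ≠ 0 := by
        obtain ⟨j, rfl⟩ := ho
        rw [pow_succ, pow_mul, Complex.I_sq]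
        rcases neg_one_pow_eq_or ℂ j with e | e <;> simp [e]
      obtain ⟨h1, h2⟩ := HalfHarmonic.isResonance_modeClass h
      exact ⟨_, h1, h2, fun _ => rfl, fun he => absurd ho (Nat.not_odd_iff_even.mpr he)⟩
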